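/- Identify functions on $\mathbb S^1=\mathbb R/2\pi\mathbb Z$ with $2\pi$-periodic functions on $\mathbb R$. Let $a,A\in W^{1,\infty}(\mathbb S^1,\mathbb R)$ (continuous representatives), put $\widetilde a=\frac1{2\pi}\int_0^{2\pi}a(s)\,ds$, and assume that $\widetilde A=\frac1{2\pi}\int_0^{2\pi}A(s)\,ds\in\mathbb Z$. Let $L_{A,a}$ be the operator $$L_{A,a}\varphi=\Big(-i\frac{d}{d\theta}+A\Big)^2\varphi+a\varphi=-\varphi''+\big(a+A^2-iA'\big)\varphi-2iA\varphi'$$ in $L^2(\mathbb S^1,\mathbb C)$ with domain $H^2(\mathbb S^1,\mathbb C)$. Then its eigenvalues are real and, each repeated according to its multiplicity, form a sequence $\mu_1\le\mu_2\le\cdots$ with $\mu_k\to+\infty$. Moreover there exist $k^*,\ell\in\mathbb N$ and real numbers $\lambda_j$ ($j\in\mathbb Z$, $|j|\ge\ell$) such that $$\{\mu_k:k>k^*\}=\{\lambda_j:j\in\mathbb Z,\ |j|\ge\ell\},$$ with multiplicities (that is, $\lambda_j=\mu_{\sigma(j)}$ for a bijection $\sigma$ of $\{j\in\mathbb Z:|j|\ge\ell\}$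 onto $\{k:k>k^*\}$), and $$\lambda_j=\widetilde a+j^2+O\big(\tfrac1{|j|}\big)\quad\text{as }|j|\to\infty.$$ Furthermore, for every $j\in\mathbb Z$ with $|j|\ge\ell$ there exist $\theta_j\in[0,2\pi]$ and an eigenfunction $\phi_j$ of $L_{A,a}$ with eigenvalue $\lambda_j$ and $\int_0^{2\pi}|\phi_j(\theta)|^2\,d\theta=1$ such that $$\phi_j(\theta)=\frac1{\sqrt\pi}\,e^{-i\int_0^\theta A(t)\,dt}\cos\big(j(\theta-\theta_j)\big)+R_j(\theta),\qquad \|R_j\|_{L^\infty(\mathbb S^1)}=O\big(\tfrac1{|j|}\big)\quad\text{as }|j|\to\infty.$$ -/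

import Mathlib

open MeasureTheory Set Filter Asymptotics
open scoped Real ENNReal

/-!
Functions on the circle `S¹ = ℝ / 2πℤ` are identified with `2π`-periodic functions on `ℝ`, and the
measure on `S¹` is arc length, i.e. Lebesgue measure on one period.
-/

namespace MagneticCircle

/-- Arc length on the circle: Lebesgue measure on the period `(0, 2π]`. -/
noncomputable abbrev arc : Measure ℝ := volume.restrict (Ioc 0 (2 * π))

/-- `f ∈ W^{1,p}(S¹)`, for the continuous representative `f`: in one dimension the Sobolev
functions are the absolutely continuous functions whose almost everywhere derivative (which then
is the weak derivative) lies in `L^p`. -/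
structure MemW1 {E : Type*} [NormedAddCommGroup E] [NormedSpace ℝ E] (p : ℝ≥0∞) (f : ℝ → E) :
    Prop where
  periodic : Function.Periodic f (2 * π)
  absCont : AbsolutelyContinuousOnInterval f 0 (2 * π)
  memLp_deriv : MemLp (deriv f) p arc

/-- `φ ∈ H²(S¹, ℂ)`, for the `C¹` representative `φ`: the derivative of `φ` is in `H¹(S¹, ℂ)`. -/
structure MemH2 (φ : ℝ → ℂ) : Prop where
  periodic : Function.Periodic φ (2 * π)
  contDiff : ContDiff ℝ 1 φ
  deriv_mem : MemW1 2 (deriv φ)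

/-- The magnetic Schrödinger operator `(-i d/dθ + A)² + a` on the circle, written out as
`φ ↦ -φ'' + (a + A² - i A') φ - 2 i A φ'`. Its domain is `H²(S¹, ℂ)`. -/
noncomputable def magneticOp (A a : ℝ → ℝ) (φ : ℝ → ℂ) (θ : ℝ) : ℂ :=
  -deriv (deriv φ) θ + ((a θ : ℂ) + (A θ : ℂ) ^ 2 - Complex.I * ((deriv A θ : ℝ) : ℂ)) * φ θ
    - 2 * Complex.I * (A θ : ℂ) * deriv φ θ

/-- The mean value `(2π)⁻¹ ∫₀^{2π} f`. -/
noncomputable def mean (f : ℝ → ℝ) : ℝ := (1 / (2 * π)) * ∫ s in (0 : ℝ)..(2 * π), f s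

theorem MemW1.ae_differentiableAt {p : ℝ≥0∞} {f : ℝ → ℂ} (hf : MemW1 p f) :
    ∀ᵐ θ ∂arc, DifferentiableAt ℝ f θ := by
  rw [ae_restrict_iff' measurableSet_Ioc]
  filter_upwards [hf.absCont.boundedVariationOn.ae_differentiableAt_of_mem_uIcc] with x hx hmem
  exact hx (by rw [uIcc_of_le (by positivity)]; exact Ioc_subset_Icc_self hmem)

theorem MemH2.differentiable {φ : ℝ → ℂ} (h : MemH2 φ) : Differentiable ℝ φ :=
  h.contDiff.differentiable (by norm_num)

theorem MemH2.deriv_add_eq {φ ψ : ℝ → ℂ} (h : MemH2 φ) (k : MemH2 ψ) :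
    deriv (φ + ψ) = deriv φ + deriv ψ := by
  funext θ
  exact deriv_add (h.differentiable θ) (k.differentiable θ)

theorem MemH2.deriv_smul_eq {φ : ℝ → ℂ} (h : MemH2 φ) (c : ℂ) :
    deriv (c • φ) = c • deriv φ := by
  funext θ
  exact deriv_const_smul c (h.differentiable θ)

theorem MemH2.deriv2_add {φ ψ : ℝ → ℂ} (h : MemH2 φ) (k : MemH2 ψ) :
    deriv (deriv (φ + ψ)) =ᵐ[arc] deriv (deriv φ) + deriv (deriv ψ) := by
  rw [h.deriv_add_eq k]
  filter_upwards [h.deriv_mem.ae_differentiableAt, k.deriv_mem.ae_differentiableAt] with θ h1 h2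
  exact deriv_add h1 h2

theorem MemH2.deriv2_smul {φ : ℝ → ℂ} (h : MemH2 φ) (c : ℂ) :
    deriv (deriv (c • φ)) =ᵐ[arc] c • deriv (deriv φ) := by
  rw [h.deriv_smul_eq c]
  filter_upwards [h.deriv_mem.ae_differentiableAt] with θ h1
  exact deriv_const_smul c h1

theorem MemH2.zero : MemH2 0 := by
  have hd : deriv (0 : ℝ → ℂ) = 0 := by funext θ; exact deriv_const θ (0 : ℂ)
  refine ⟨fun _ => rfl, contDiff_const, ?_⟩
  rw [hd]
  refine ⟨fun _ => rfl, ?_, ?_⟩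
  · exact ((contDiff_const (c := (0 : ℂ))).contDiffOn).absolutelyContinuousOnInterval
  · rw [hd]; exact MemLp.zero

theorem MemH2.add {φ ψ : ℝ → ℂ} (h : MemH2 φ) (k : MemH2 ψ) : MemH2 (φ + ψ) := by
  refine ⟨h.periodic.add k.periodic, h.contDiff.add k.contDiff, ?_, ?_, ?_⟩
  · rw [h.deriv_add_eq k]; exact h.deriv_mem.periodic.add k.deriv_mem.periodic
  · rw [h.deriv_add_eq k]; exact h.deriv_mem.absCont.add k.deriv_mem.absCont
  · exact (h.deriv_mem.memLp_deriv.add k.deriv_mem.memLp_deriv).ae_eq (h.deriv2_add k).symm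

theorem MemH2.smul {φ : ℝ → ℂ} (h : MemH2 φ) (c : ℂ) : MemH2 (c • φ) := by
  refine ⟨h.periodic.smul c, contDiff_const.smul h.contDiff, ?_, ?_, ?_⟩
  · rw [h.deriv_smul_eq c]; exact h.deriv_mem.periodic.smul c
  · rw [h.deriv_smul_eq c]; exact h.deriv_mem.absCont.const_smul c
  · exact (h.deriv_mem.memLp_deriv.const_smul c).ae_eq (h.deriv2_smul c).symm

/-- The eigenspace `{φ ∈ H²(S¹, ℂ) : (-i d/dθ + A)² φ + a φ = z φ almost everywhere}`. -/
noncomputable def eigenspace (A a : ℝ → ℝ) (z : ℂ) : Submodule ℂ (ℝ → ℂ) where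
  carrier := {φ | MemH2 φ ∧ ∀ᵐ θ ∂arc, magneticOp A a φ θ = z * φ θ}
  zero_mem' := by
    have hd : deriv (0 : ℝ → ℂ) = 0 := by funext θ; exact deriv_const θ (0 : ℂ)
    refine ⟨MemH2.zero, Eventually.of_forall fun θ => ?_⟩
    simp [magneticOp, hd]
  add_mem' := by
    rintro φ ψ ⟨h, h1⟩ ⟨k, k1⟩
    refine ⟨h.add k, ?_⟩
    filter_upwards [h1, k1, h.deriv2_add k] with θ e1 e2 e3
    have e4 := congrFun (h.deriv_add_eq k) θ
    simp only [magneticOp, Pi.add_apply] at *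
    rw [e3, e4]
    linear_combination e1 + e2
  smul_mem' := by
    rintro c φ ⟨h, h1⟩
    refine ⟨h.smul c, ?_⟩
    filter_upwards [h1, h.deriv2_smul c] with θ e1 e3
    have e4 := congrFun (h.deriv_smul_eq c) θ
    simp only [magneticOp, Pi.smul_apply, smul_eq_mul] at *
    rw [e3, e4]
    linear_combination c * e1

/-- `μ 0 ≤ μ 1 ≤ μ 2 ≤ ⋯` is the list of all eigenvalues of the operator, each of them repeated
according to its multiplicity: every complex number `z` occurs in the list exactly
`dim (eigenspace A a z)` times; in particular there are no non-real eigenvalues. -/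
structure IsEigenvalueSeq (A a : ℝ → ℝ) (μ : ℕ → ℝ) : Prop where
  mono : Monotone μ
  mult : ∀ z : ℂ,
    {k : ℕ | (μ k : ℂ) = z}.encard = Cardinal.toENat (Module.rank ℂ (eigenspace A a z))

end MagneticCircle

/-! Gauge. Multiplication by `exp (i ∫₀^θ A)` turns `(-i d/dθ + A)² + a` into Hill's operator `H =
-d²/dx² + a`. Since the mean of `A` is an integer, this factor is `2π`-periodic, so it identifies
the two eigenspaces for every `z`, and it has modulus one. All terms with `A'` cancel and `a` is
continuous, so the Hill eigenfunctions are classical solutions. It remains to study periodic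
solutions of `-u'' + a u = l u` with `|a| ≤ α`.

Upper count. Eigenfunctions to distinct eigenvalues are orthogonal, so a sum `u` of eigenfunctions
with eigenvalues within `C` of `c` satisfies `u'' + c u = h + a u` with `‖h‖ ≤ C ‖u‖` in `L²`. If
`u` has no frequency `k` with `k²` close to `c`, Parseval bounds `‖u'' + c u‖` below by a large
multiple of `‖u‖`, and so `u = 0`. Hence finitely many Fourier coefficients are injective on the sum
of these eigenspaces (`sum_finrank_hillSpace_le`). This gives finite multiplicities, the closeness
of every eigenvalue to some `n²`, and at most two eigenvalues near a large `n²`.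

Lower count. Near `n²` a Lyapunov–Schmidt reduction is made. With `l = n² + μ`, the equation `w = x
cos nt + y sin nt + G((a - μ) w)` is solved by a Neumann series, because `G` has norm `O(1/n)`. The
solution is periodic for Hill's equation once `(a - μ) w` is orthogonal to `cos nt` and `sin nt`,
which is a 2×2 linear system in `(x, y)`. The kernel of `G` is symmetric, hence so is the matrix. It
is positive definite at `μ = -(2α + 1)` and negative definite at `μ = 2α + 1`, so each of its two
eigenvalues vanishes in between (`exists_two_singular`). With the upper bound, exactly two
eigenvalues with multiplicity lie near each large `n²`; they are labelled `n` and `-n`.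

Asymptotics. Variation of constants shows that a normalised real eigenfunction is `π^{-1/2} cos(n(t
- θ)) + O(1/n)`. Testing the equation against `cos(n(t - θ))` gives `∫ cos²(n(t - θ)) (a - d) =
O(1/n)` for `d = l - n²`. The integral is `π (mean a - d)` plus a Fourier coefficient of `a` at
frequency `2n`, which is `O(1/n)` after one integration by parts. -/

namespace MagneticCircle

/-! ### Hill's equation and periodic functions -/

/-- The classical `2π`-periodic solutions of Hill's equation `-u'' + a u = z u`. -/
noncomputable def hillSpace (a : ℝ → ℝ) (z : ℂ) : Submodule ℂ (ℝ → ℂ) where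
  carrier := {u | Function.Periodic u (2 * π) ∧ ∃ v : ℝ → ℂ,
    (∀ x, HasDerivAt u (v x) x) ∧ ∀ x, HasDerivAt v (((a x : ℂ) - z) * u x) x}
  zero_mem' := ⟨fun _ => rfl, 0, fun x => hasDerivAt_const x 0, fun x => by
    simp⟩
  add_mem' := by
    rintro u₁ u₂ ⟨p₁, v₁, h₁, k₁⟩ ⟨p₂, v₂, h₂, k₂⟩
    refine ⟨p₁.add p₂, v₁ + v₂, fun x => (h₁ x).add (h₂ x), fun x => ?_⟩
    refine HasDerivAt.congr_deriv ((k₁ x).add (k₂ x)) ?_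
    exact (mul_add ((a x : ℂ) - z) (u₁ x) (u₂ x)).symm
  smul_mem' := by
    rintro c u ⟨p, v, h, k⟩
    refine ⟨p.smul c, c • v, fun x => (h x).const_smul c, fun x => ?_⟩
    refine HasDerivAt.congr_deriv ((k x).const_smul c) ?_
    exact mul_left_comm c ((a x : ℂ) - z) (u x)

theorem eq_of_periodic_of_eqOn {E : Type*} {f g : ℝ → E} {T : ℝ} (hT : 0 < T)
    (hf : Function.Periodic f T) (hg : Function.Periodic g T) (h : ∀ x ∈ Icc 0 T, f x = g x) :
    f = g := by
  have hp : Function.Periodic (fun x => (f x, g x)) T := fun x => by simp only [hf x, hg x]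
  funext x
  obtain ⟨y, hy, hxy⟩ := hp.exists_mem_Ico₀ hT x
  simp only [Prod.mk.injEq] at hxy
  rw [hxy.1, hxy.2, h y (Ico_subset_Icc_self hy)]

theorem continuous_of_periodic_of_continuousOn {E : Type*} [TopologicalSpace E] {f : ℝ → E} {T : ℝ}
    (hT : 0 < T) (hf : Function.Periodic f T) (h : ContinuousOn f (Icc 0 T)) : Continuous f := by
  have : Fact (0 < T) := ⟨hT⟩
  have h0 : f 0 = f (0 + T) := (hf 0).symm
  have hc := AddCircle.liftIco_continuous (p := T) h0 (by simpa using h)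
  have he : f = fun x : ℝ => AddCircle.liftIco T 0 f (x : AddCircle T) := by
    refine eq_of_periodic_of_eqOn hT hf (fun x => by simp) fun x hx => ?_
    rcases eq_or_lt_of_le hx.2 with rfl | hlt
    · have : ((x : ℝ) : AddCircle x) = ((0 : ℝ) : AddCircle x) := by
        simp
      rw [this, AddCircle.liftIco_coe_apply (by simp [hT]), h0, zero_add]
    · rw [AddCircle.liftIco_coe_apply (by simpa using ⟨hx.1, hlt⟩)]
  rw [he]
  exact hc.comp (AddCircle.continuous_mk' T)

theorem MemW1.continuous {E : Type*} [NormedAddCommGroup E] [NormedSpace ℝ E] {p : ℝ≥0∞}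
    {f : ℝ → E} (hf : MemW1 p f) : Continuous f :=
  continuous_of_periodic_of_continuousOn Real.two_pi_pos hf.periodic
    (by simpa [uIcc_of_le Real.two_pi_pos.le] using hf.absCont.continuousOn)

theorem ae_of_ae_arc {p : ℝ → Prop} (h : ∀ᵐ x ∂arc, p x) :
    ∀ᵐ x, x ∈ uIcc 0 (2 * π) → p x := by
  rw [uIcc_of_le Real.two_pi_pos.le, ← ae_restrict_iff' measurableSet_Icc,
    ← restrict_Ioc_eq_restrict_Icc]
  exact h

theorem hasDerivAt_primitive {E : Type*} [NormedAddCommGroup E] [NormedSpace ℝ E] [CompleteSpace E]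
    {f : ℝ → E} (hf : Continuous f) (x : ℝ) : HasDerivAt (fun y => ∫ t in (0 : ℝ)..y, f t) (f x) x :=
  (hf.integral_hasStrictDerivAt 0 x).hasDerivAt

theorem primitive_add_period {E : Type*} [NormedAddCommGroup E] [NormedSpace ℝ E]
    {f : ℝ → E} (hf : Continuous f) {T : ℝ} (hp : Function.Periodic f T) (x : ℝ) :
    ∫ t in (0 : ℝ)..(x + T), f t = (∫ t in (0 : ℝ)..x, f t) + ∫ t in (0 : ℝ)..T, f t := by
  simpa using hp.intervalIntegral_add_eq_add 0 x fun _ _ => hf.intervalIntegrable _ _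

/-! ### The gauge transformation -/

/-- The function `θ ↦ exp (s i ∫₀^θ A)`, which gauges away the magnetic potential. -/
noncomputable def gauge (A : ℝ → ℝ) (s : ℂ) (t : ℝ) : ℂ :=
  Complex.exp (s * Complex.I * ((∫ x in (0 : ℝ)..t, A x : ℝ) : ℂ))

theorem hasDerivAt_gauge {A : ℝ → ℝ} (hA : Continuous A) (s : ℂ) (t : ℝ) :
    HasDerivAt (gauge A s) (s * Complex.I * A t * gauge A s t) t := by
  have h := (((hasDerivAt_primitive hA t).ofReal_comp).const_mul (s * Complex.I)).cexp
  refine HasDerivAt.congr_deriv (h) ?_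
  simp only [gauge]; ring

theorem continuous_gauge {A : ℝ → ℝ} (hA : Continuous A) (s : ℂ) : Continuous (gauge A s) :=
  continuous_iff_continuousAt.2 fun t => (hasDerivAt_gauge hA s t).continuousAt

theorem gauge_neg_mul (A : ℝ → ℝ) (s : ℂ) (t : ℝ) : gauge A (-s) t * gauge A s t = 1 := by
  rw [gauge, gauge, ← Complex.exp_add]
  simp

theorem norm_gauge_neg_one (A : ℝ → ℝ) (t : ℝ) : ‖gauge A (-1) t‖ = 1 := by
  rw [gauge, show (-1 : ℂ) * Complex.I * ((∫ x in (0 : ℝ)..t, A x : ℝ) : ℂ)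
    = ((-∫ x in (0 : ℝ)..t, A x : ℝ) : ℂ) * Complex.I by push_cast; ring,
    Complex.norm_exp_ofReal_mul_I]

/-- Over one period the exponent grows by `2πi s n`. This is the point at which the integrality of
the mean of `A` is used. -/
theorem periodic_gauge {A : ℝ → ℝ} (hA : Continuous A) (hp : Function.Periodic A (2 * π))
    {n : ℤ} (hn : mean A = n) (s : ℤ) : Function.Periodic (gauge A s) (2 * π) := by
  intro t
  have h : ∫ x in (0 : ℝ)..(2 * π), A x = n * (2 * π) := by
    rw [← hn, mean]; field_simp
  rw [gauge, gauge, primitive_add_period hA hp, h, Complex.exp_eq_exp_iff_exists_int]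
  exact ⟨s * n, by push_cast; ring⟩

theorem absCont_gauge {A : ℝ → ℝ} (hA : Continuous A) (s : ℂ) (x y : ℝ) :
    AbsolutelyContinuousOnInterval (gauge A s) x y := by
  refine ContDiffOn.absolutelyContinuousOnInterval (ContDiff.contDiffOn ?_)
  rw [contDiff_one_iff_deriv]
  refine ⟨fun t => (hasDerivAt_gauge hA s t).differentiableAt, ?_⟩
  rw [funext fun t => (hasDerivAt_gauge hA s t).deriv]
  have := continuous_gauge hA s
  fun_prop

theorem absCont_of_hasDerivAt {f f' : ℝ → ℂ} (h : ∀ x, HasDerivAt f (f' x) x)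
    (hf' : Continuous f') (x y : ℝ) : AbsolutelyContinuousOnInterval f x y := by
  refine ContDiffOn.absolutelyContinuousOnInterval (ContDiff.contDiffOn ?_)
  rw [contDiff_one_iff_deriv]
  refine ⟨fun t => (h t).differentiableAt, ?_⟩
  rwa [funext fun t => (h t).deriv]

/-- The gauged function is a priori only an almost everywhere solution. Its derivative `v` is
absolutely continuous and `v' = (a - z) u` almost everywhere, with the `A'` terms cancelling. Since
the right side is continuous, `v` is the primitive of a continuous function, and the equation holds
at every point. -/
theorem gauge_mul_mem_hillSpace {A a : ℝ → ℝ} {p q : ℝ≥0∞} (ha : MemW1 p a) (hA : MemW1 q A)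
    {n : ℤ} (hn : mean A = n) {z : ℂ} {φ : ℝ → ℂ} (hφ : φ ∈ eigenspace A a z) :
    gauge A 1 * φ ∈ hillSpace a z := by
  obtain ⟨hφ, heq⟩ := hφ
  have hac := ha.continuous
  have hAc := hA.continuous
  have hE := hasDerivAt_gauge hAc 1
  have hEp : Function.Periodic (gauge A 1) (2 * π) := by
    simpa using periodic_gauge hAc hA.periodic hn 1
  have hEc := continuous_gauge hAc 1
  have hφd : ∀ x, HasDerivAt φ (deriv φ x) x := fun x => (hφ.differentiable x).hasDerivAt
  have hφc : Continuous φ := hφ.differentiable.continuous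
  set v : ℝ → ℂ := fun x => gauge A 1 x * (deriv φ x + Complex.I * (A x • φ x)) with hv
  have hu : ∀ x, HasDerivAt (gauge A 1 * φ) (v x) x := fun x => by
    refine HasDerivAt.congr_deriv ((hE x).mul (hφd x)) ?_
    simp only [hv, Complex.real_smul]; ring
  have hvp : Function.Periodic v (2 * π) := fun x => by
    simp only [hv, hEp x, hφ.deriv_mem.periodic x, hA.periodic x, hφ.periodic x]
  have huc : Continuous (gauge A 1 * φ) := hEc.mul hφc
  have hgc : Continuous fun x => ((a x : ℂ) - z) * (gauge A 1 * φ) x := by fun_prop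
  have hvac : AbsolutelyContinuousOnInterval v 0 (2 * π) :=
    (absCont_gauge hAc 1 _ _).fun_smul (hφ.deriv_mem.absCont.fun_add
      ((hA.absCont.fun_smul
        (absCont_of_hasDerivAt hφd hφ.deriv_mem.continuous _ _)).const_smul Complex.I))
  have hFac : AbsolutelyContinuousOnInterval
      (fun x => ∫ t in (0 : ℝ)..x, ((a t : ℂ) - z) * (gauge A 1 * φ) t) 0 (2 * π) :=
    absCont_of_hasDerivAt (hasDerivAt_primitive hgc) hgc _ _
  have hdA : ∀ᵐ x, x ∈ uIcc 0 (2 * π) → DifferentiableAt ℝ A x := hA.absCont.ae_differentiableAt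
  -- An absolutely continuous function with almost everywhere vanishing derivative is constant; this
  -- is applied to `v` minus the primitive of `(a - z) u`.
  obtain ⟨c, hc⟩ := (hvac.sub hFac).const_of_ae_hasDerivAt_zero (by
    filter_upwards [hdA, ae_of_ae_arc heq, ae_of_ae_arc hφ.deriv_mem.ae_differentiableAt]
      with x h1 h2 h3 hx
    have k1 := (h1 hx).hasDerivAt
    have k2 := h2 hx
    have k3 := (h3 hx).hasDerivAt
    have k := ((hE x).mul (k3.add ((k1.smul (hφd x)).const_mul Complex.I))).sub
      (hasDerivAt_primitive hgc x)
    refine HasDerivAt.congr_deriv (k) ?_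
    simp only [magneticOp] at k2
    simp only [Complex.real_smul, Pi.mul_apply, Pi.add_apply, Pi.smul_apply']
    have := Complex.I_sq
    linear_combination -(gauge A 1 x) * k2 + (gauge A 1 x) * (A x) ^ 2 * φ x * this)
  have hFv : ∀ x ∈ Icc 0 (2 * π),
      v x = c + ∫ t in (0 : ℝ)..x, ((a t : ℂ) - z) * (gauge A 1 * φ) t := fun x hx => by
    have := hc x (by rwa [uIcc_of_le Real.two_pi_pos.le])
    simp only [Pi.sub_apply] at this
    rw [← this]; ring
  -- The primitive is periodic because `v` returns to its value after one period; this carries the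
  -- formula for `v` from `[0, 2π]` to the whole line.
  have hzero : ∫ t in (0 : ℝ)..(2 * π), ((a t : ℂ) - z) * (gauge A 1 * φ) t = 0 := by
    have h0 := hFv 0 ⟨le_rfl, Real.two_pi_pos.le⟩
    have h1 := hFv (2 * π) ⟨Real.two_pi_pos.le, le_rfl⟩
    have h2 := hvp 0
    rw [zero_add, h0, h1] at h2
    simpa using h2
  have hgp : Function.Periodic (fun x => ((a x : ℂ) - z) * (gauge A 1 * φ) x) (2 * π) :=
    fun x => by simp only [Pi.mul_apply, ha.periodic x, hEp x, hφ.periodic x]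
  have hFp : v = fun x => c + ∫ t in (0 : ℝ)..x, ((a t : ℂ) - z) * (gauge A 1 * φ) t :=
    eq_of_periodic_of_eqOn Real.two_pi_pos hvp
      (fun x => by simp only [primitive_add_period hgc hgp, hzero, add_zero]) hFv
  refine ⟨hEp.mul hφ.periodic, v, hu, fun x => ?_⟩
  rw [hFp]
  exact (hasDerivAt_primitive hgc x).const_add c

theorem gauge_mul_mem_eigenspace {A a : ℝ → ℝ} {p : ℝ≥0∞} (ha : MemW1 p a) (hA : MemW1 ⊤ A)
    {n : ℤ} (hn : mean A = n) {z : ℂ} {u : ℝ → ℂ} (hu : u ∈ hillSpace a z) :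
    gauge A (-1) * u ∈ eigenspace A a z := by
  obtain ⟨hup, v, huv, hvu⟩ := hu
  have hac := ha.continuous
  have hAc := hA.continuous
  have hE := hasDerivAt_gauge hAc (-1)
  have hEp : Function.Periodic (gauge A (-1)) (2 * π) := by
    simpa using periodic_gauge hAc hA.periodic hn (-1)
  have hEc := continuous_gauge hAc (-1)
  have huc : Continuous u := continuous_iff_continuousAt.2 fun x => (huv x).continuousAt
  have hvc : Continuous v := continuous_iff_continuousAt.2 fun x => (hvu x).continuousAt
  have hvp : Function.Periodic v (2 * π) := fun x => by
    have h1 := (huv (x + 2 * π)).comp_add_const x (2 * π)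
    rw [show (fun y => u (y + 2 * π)) = u from funext hup] at h1
    exact h1.unique (huv x)
  have hd : ∀ x, HasDerivAt (gauge A (-1) * u)
      (gauge A (-1) x * (v x - Complex.I * (A x • u x))) x := fun x => by
    refine HasDerivAt.congr_deriv ((hE x).mul (huv x)) ?_
    simp only [Complex.real_smul]; ring
  have hdd : deriv (gauge A (-1) * u) =
      fun x => gauge A (-1) x * (v x - Complex.I * (A x • u x)) := funext fun x => (hd x).deriv
  have hd2 : ∀ x, DifferentiableAt ℝ A x → HasDerivAt (deriv (gauge A (-1) * u))
      (gauge A (-1) x * (((a x : ℂ) - z) * u x - 2 * Complex.I * A x * v x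
        - (A x : ℂ) ^ 2 * u x) - Complex.I * gauge A (-1) x * u x * ((deriv A x : ℝ) : ℂ)) x := by
    intro x hx
    rw [hdd]
    refine HasDerivAt.congr_deriv ((hE x).mul ((hvu x).sub ((hx.hasDerivAt.smul (huv x)).const_mul Complex.I))) ?_
    simp only [Complex.real_smul]
    have := Complex.I_sq
    linear_combination (gauge A (-1) x) * (A x) ^ 2 * u x * this
  have hdA : ∀ᵐ x ∂arc, DifferentiableAt ℝ A x := by
    rw [ae_restrict_iff' measurableSet_Ioc]
    filter_upwards [hA.absCont.ae_differentiableAt] with x hx hmem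
    exact hx (by rw [uIcc_of_le Real.two_pi_pos.le]; exact Ioc_subset_Icc_self hmem)
  have hbdd : ∀ f : ℝ → ℂ, Continuous f → MemLp f ⊤ arc := fun f hf => by
    obtain ⟨C, hC⟩ := isCompact_Icc.exists_bound_of_continuousOn (s := Icc 0 (2 * π)) hf.continuousOn
    refine memLp_top_of_bound hf.aestronglyMeasurable C ?_
    rw [ae_restrict_iff' measurableSet_Ioc]
    exact Eventually.of_forall fun x hx => hC x (Ioc_subset_Icc_self hx)
  refine ⟨⟨hEp.mul hup, ?_, ?_, ?_, ?_⟩, ?_⟩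
  · rw [contDiff_one_iff_deriv]
    refine ⟨fun t => (hd t).differentiableAt, ?_⟩
    rw [hdd]; fun_prop
  · rw [hdd]
    exact fun x => by simp only [hEp x, hvp x, hA.periodic x, hup x]
  · rw [hdd]
    exact (absCont_gauge hAc (-1) _ _).fun_smul
      ((absCont_of_hasDerivAt hvu (by fun_prop) _ _).fun_sub
      ((hA.absCont.fun_smul (absCont_of_hasDerivAt huv hvc _ _)).const_smul Complex.I))
  -- The second derivative is a continuous function minus a continuous multiple of `A'`. As `A'` is
  -- essentially bounded, it lies in `L^∞`, hence in `L²` of the finite measure `arc`.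
  · have h1 : MemLp (fun x => ((deriv A x : ℝ) : ℂ)) ⊤ arc := hA.memLp_deriv.ofReal
    have h2 := hbdd (fun x => gauge A (-1) x * (((a x : ℂ) - z) * u x
      - 2 * Complex.I * A x * v x - (A x : ℂ) ^ 2 * u x)) (by fun_prop)
    have h3 := hbdd (fun x => Complex.I * gauge A (-1) x * u x) (by fun_prop)
    have h4 := h2.sub (h1.mul (r := ⊤) h3)
    refine (h4.mono_exponent le_top).ae_eq ?_
    filter_upwards [hdA] with x hx
    rw [(hd2 x hx).deriv]; rfl
  · filter_upwards [hdA] with x hx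
    simp only [magneticOp]
    rw [(hd2 x hx).deriv, hdd]
    simp only [Pi.mul_apply, Complex.real_smul]
    have := Complex.I_sq
    linear_combination 2 * (gauge A (-1) x) * (A x) ^ 2 * u x * this

/-- The two gauge factors are inverse to each other, so multiplication by them is a linear
equivalence. -/
theorem rank_eigenspace {A a : ℝ → ℝ} {p : ℝ≥0∞} (ha : MemW1 p a) (hA : MemW1 ⊤ A)
    {n : ℤ} (hn : mean A = n) (z : ℂ) :
    Module.rank ℂ (eigenspace A a z) = Module.rank ℂ (hillSpace a z) := by
  have h1 : gauge A (-1) * gauge A 1 = 1 := funext fun t => gauge_neg_mul A 1 t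
  have h2 : gauge A 1 * gauge A (-1) = 1 := by rw [mul_comm, h1]
  refine LinearEquiv.rank_eq
    { toFun := fun φ => ⟨gauge A 1 * φ.1, gauge_mul_mem_hillSpace ha hA hn φ.2⟩
      invFun := fun u => ⟨gauge A (-1) * u.1, gauge_mul_mem_eigenspace ha hA hn u.2⟩
      map_add' := fun φ ψ => Subtype.ext (mul_add _ _ _)
      map_smul' := fun c φ => Subtype.ext (mul_smul_comm _ _ _)
      left_inv := fun φ => Subtype.ext (by simp only [← mul_assoc, h1, one_mul])
      right_inv := fun u => Subtype.ext (by simp only [← mul_assoc, h2, one_mul]) }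

/-! ### Fourier coefficients and the spectral gap -/

/-- The (unnormalised) Fourier coefficient `∫₀^{2π} e^{-ikt} u(t) dt`. -/
noncomputable def circleCoeff (u : ℝ → ℂ) (k : ℤ) : ℂ :=
  ∫ t in (0 : ℝ)..(2 * π), Complex.exp (-(Complex.I * k * t)) * u t

theorem circleCoeff_eq (u : ℝ → ℂ) (k : ℤ) :
    fourierCoeffOn Real.two_pi_pos u k = (1 / (2 * π) : ℝ) * circleCoeff u k := by
  rw [fourierCoeffOn_eq_integral, circleCoeff, Complex.real_smul, sub_zero]
  congr 1
  refine intervalIntegral.integral_congr fun t _ => ?_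
  simp only [fourier_coe_apply, smul_eq_mul]
  congr 2
  push_cast
  have : (π : ℂ) ≠ 0 := by exact_mod_cast Real.pi_ne_zero
  field_simp

theorem hasSum_norm_sq_circleCoeff {u : ℝ → ℂ} (hu : Continuous u) :
    HasSum (fun k => ‖circleCoeff u k‖ ^ 2) (2 * π * ∫ t in (0 : ℝ)..(2 * π), ‖u t‖ ^ 2) := by
  have hm : MemLp u 2 arc := by
    obtain ⟨C, hC⟩ := isCompact_Icc.exists_bound_of_continuousOn (s := Icc 0 (2 * π)) hu.continuousOn
    refine (memLp_top_of_bound hu.aestronglyMeasurable C ?_).mono_exponent le_top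
    rw [ae_restrict_iff' measurableSet_Ioc]
    exact Eventually.of_forall fun x hx => hC x (Ioc_subset_Icc_self hx)
  have h := (hasSum_sq_fourierCoeffOn Real.two_pi_pos hm).mul_left ((2 * π) ^ 2)
  simp only [circleCoeff_eq, sub_zero, smul_eq_mul, norm_mul, Complex.norm_real, mul_pow] at h
  have hpi := Real.pi_pos
  rw [Real.norm_of_nonneg (by positivity)] at h
  have e1 : ∀ x : ℝ, 2 ^ 2 * π ^ 2 * ((1 / (2 * π)) ^ 2 * x) = x := fun x => by field_simp
  have e2 : ∀ x : ℝ, 2 ^ 2 * π ^ 2 * ((2 * π)⁻¹ * x) = 2 * π * x := fun x => by field_simp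
  simpa only [e1, e2] using h

theorem periodic_deriv {u v : ℝ → ℂ} {T : ℝ} (hu : Function.Periodic u T)
    (h : ∀ x, HasDerivAt u (v x) x) : Function.Periodic v T := fun x => by
  have h1 := (h (x + T)).comp_add_const x T
  rw [show (fun y => u (y + T)) = u from funext hu] at h1
  exact h1.unique (h x)

theorem integral_deriv_periodic {f f' : ℝ → ℂ} {T : ℝ} (hf : Function.Periodic f T)
    (h : ∀ x, HasDerivAt f (f' x) x) (hc : Continuous f') : ∫ t in (0 : ℝ)..T, f' t = 0 := by
  rw [intervalIntegral.integral_eq_sub_of_hasDerivAt (fun x _ => h x) (hc.intervalIntegrable _ _)]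
  have := hf 0
  rw [zero_add] at this
  rw [this, sub_self]

theorem hasDerivAt_character (k : ℤ) (x : ℝ) :
    HasDerivAt (fun t : ℝ => Complex.exp (-(Complex.I * k * t)))
      (-(Complex.I * k) * Complex.exp (-(Complex.I * k * x))) x := by
  have h := (((hasDerivAt_id x).ofReal_comp).const_mul (-(Complex.I * k))).cexp
  simp only [id, neg_mul] at h
  refine h.congr_deriv ?_
  push_cast; ring

theorem circleCoeff_deriv {u v : ℝ → ℂ} (hu : Function.Periodic u (2 * π))
    (h : ∀ x, HasDerivAt u (v x) x) (hv : Continuous v) (k : ℤ) :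
    circleCoeff v k = Complex.I * k * circleCoeff u k := by
  have hp : Function.Periodic (fun t : ℝ => Complex.exp (-(Complex.I * k * t))) (2 * π) := fun t => by
    simp only
    rw [Complex.exp_eq_exp_iff_exists_int]
    exact ⟨-k, by push_cast; ring⟩
  have huc : Continuous u := continuous_iff_continuousAt.2 fun x => (h x).continuousAt
  have h0 := integral_deriv_periodic (hp.mul hu) (fun x => (hasDerivAt_character k x).mul (h x))
    (by fun_prop)
  rw [intervalIntegral.integral_add (Continuous.intervalIntegrable (by fun_prop) _ _)
    (Continuous.intervalIntegrable (by fun_prop) _ _)] at h0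
  simp only [mul_assoc] at h0
  rw [intervalIntegral.integral_const_mul] at h0
  simp only [circleCoeff, mul_assoc]
  linear_combination h0

/-- A spectral gap of `-d²/dx²` on functions without the frequencies in `S`. -/
theorem le_integral_norm_sq_of_circleCoeff_eq_zero {u v w : ℝ → ℂ}
    (hu : Function.Periodic u (2 * π)) (huv : ∀ x, HasDerivAt u (v x) x)
    (hvw : ∀ x, HasDerivAt v (w x) x) (hw : Continuous w) {S : Set ℤ} {c d : ℝ} (hd : 0 ≤ d)
    (hS : ∀ k ∉ S, d ≤ |(k : ℝ) ^ 2 - c|) (h0 : ∀ k ∈ S, circleCoeff u k = 0) :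
    d ^ 2 * ∫ t in (0 : ℝ)..(2 * π), ‖u t‖ ^ 2 ≤
      ∫ t in (0 : ℝ)..(2 * π), ‖w t + c * u t‖ ^ 2 := by
  have huc : Continuous u := continuous_iff_continuousAt.2 fun x => (huv x).continuousAt
  have hvc : Continuous v := continuous_iff_continuousAt.2 fun x => (hvw x).continuousAt
  -- On the Fourier side `d²/dx² + c` is multiplication by `c - k²`. The claim then follows by
  -- comparing the Parseval sums term by term; the terms with `k ∈ S` vanish on the left.
  have h1 : ∀ k, circleCoeff (fun t => w t + c * u t) k = ((c - (k : ℝ) ^ 2 : ℝ) : ℂ) * circleCoeff u k := by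
    intro k
    have e1 := circleCoeff_deriv hu huv hvc k
    have e2 := circleCoeff_deriv (periodic_deriv hu huv) hvw hw k
    have e3 : circleCoeff (fun t => w t + c * u t) k = circleCoeff w k + c * circleCoeff u k := by
      simp only [circleCoeff]
      rw [← intervalIntegral.integral_const_mul, ← intervalIntegral.integral_add
        (Continuous.intervalIntegrable (by fun_prop) _ _)
        (Continuous.intervalIntegrable (by fun_prop) _ _)]
      exact intervalIntegral.integral_congr fun t _ => by ring
    rw [e3, e2, e1]
    push_cast
    linear_combination (k : ℂ) ^ 2 * circleCoeff u k * Complex.I_sq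
  have h2 := hasSum_le (fun k => ?_) ((hasSum_norm_sq_circleCoeff huc).mul_left (d ^ 2))
    (hasSum_norm_sq_circleCoeff (u := fun t => w t + c * u t) (by fun_prop))
  · have := Real.pi_pos
    rw [mul_left_comm] at h2
    exact le_of_mul_le_mul_left h2 (by positivity)
  · by_cases hk : k ∈ S
    · simp only [h0 k hk, norm_zero, ne_eq, OfNat.ofNat_ne_zero, not_false_eq_true, zero_pow,
        mul_zero]
      positivity
    · rw [h1, norm_mul, mul_pow, Complex.norm_real, Real.norm_eq_abs, abs_sub_comm]
      gcongr
      exact hS k hk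

/-! ### Orthogonality and upper bounds for multiplicities -/

theorem hillSpace.continuous {a : ℝ → ℝ} {z : ℂ} {u : ℝ → ℂ} (hu : u ∈ hillSpace a z) :
    Continuous u := by
  obtain ⟨-, v, h, -⟩ := hu
  exact continuous_iff_continuousAt.2 fun x => (h x).continuousAt

/-- The Wronskian of `f` and `conj g` is periodic and has derivative `(conj w - z) f conj g`. The
hypothesis in this form covers both distinct real eigenvalues and, with `f = g` and `z = w` not
real, the absence of non-real eigenvalues. -/
theorem hillSpace_orthogonal {a : ℝ → ℝ} {z w : ℂ}
    (hzw : (starRingEnd ℂ) w ≠ z) {f g : ℝ → ℂ} (hf : f ∈ hillSpace a z) (hg : g ∈ hillSpace a w) :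
    ∫ t in (0 : ℝ)..(2 * π), f t * (starRingEnd ℂ) (g t) = 0 := by
  have hfc := hillSpace.continuous hf
  have hgc := hillSpace.continuous hg
  obtain ⟨pf, f', hf1, hf2⟩ := hf
  obtain ⟨pg, g', hg1, hg2⟩ := hg
  have c1 : ∀ x, HasDerivAt (fun t => (starRingEnd ℂ) (g t)) ((starRingEnd ℂ) (g' x)) x :=
    fun x => (hg1 x).star
  have c2 : ∀ x, HasDerivAt (fun t => (starRingEnd ℂ) (g' t))
      ((starRingEnd ℂ) (((a x : ℂ) - w) * g x)) x := fun x => (hg2 x).star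
  have pg' := periodic_deriv pg hg1
  have h0 := integral_deriv_periodic (T := 2 * π)
    (f' := fun t => ((starRingEnd ℂ) w - z) * (f t * (starRingEnd ℂ) (g t)))
    (f := fun t => f' t * (starRingEnd ℂ) (g t) - f t * (starRingEnd ℂ) (g' t))
    (fun t => by simp only [pf t, pg t, pg' t, periodic_deriv pf hf1 t])
    (fun x => by
      refine (((hf2 x).mul (c1 x)).sub ((hf1 x).mul (c2 x))).congr_deriv ?_
      simp only [map_mul, map_sub, Complex.conj_ofReal]; ring)
    (by have := Complex.continuous_conj; fun_prop)
  rw [intervalIntegral.integral_const_mul] at h0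
  exact (mul_eq_zero.1 h0).resolve_left (sub_ne_zero.2 hzw)

theorem eq_zero_of_integral_norm_sq {u : ℝ → ℂ} (hc : Continuous u)
    (hp : Function.Periodic u (2 * π)) (h : ∫ t in (0 : ℝ)..(2 * π), ‖u t‖ ^ 2 ≤ 0) : u = 0 := by
  refine eq_of_periodic_of_eqOn Real.two_pi_pos hp (fun _ => rfl) fun x hx => ?_
  by_contra hne
  have := intervalIntegral.integral_pos (f := fun t => ‖u t‖ ^ 2) Real.two_pi_pos
    (by fun_prop) (fun _ _ => by positivity) ⟨x, hx, by
      have : 0 < ‖u x‖ := norm_pos_iff.2 hne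
      positivity⟩
  linarith

theorem integral_norm_sq_eq {u : ℝ → ℂ} :
    ((∫ t in (0 : ℝ)..(2 * π), ‖u t‖ ^ 2 : ℝ) : ℂ) =
      ∫ t in (0 : ℝ)..(2 * π), u t * (starRingEnd ℂ) (u t) := by
  rw [← intervalIntegral.integral_ofReal]
  exact intervalIntegral.integral_congr fun t _ => by
    simp only [Complex.mul_conj, Complex.normSq_eq_norm_sq]

theorem hillSpace_eq_bot_of_im_ne_zero {a : ℝ → ℝ} {z : ℂ} (hz : z.im ≠ 0) :
    hillSpace a z = ⊥ := by
  rw [eq_bot_iff]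
  intro u hu
  have h := hillSpace_orthogonal (fun h => hz (Complex.conj_eq_iff_im.1 h)) hu hu
  rw [← integral_norm_sq_eq] at h
  exact eq_zero_of_integral_norm_sq (hillSpace.continuous hu) hu.1 (Complex.ofReal_eq_zero.1 h).le

theorem integral_norm_sq_sum {ι : Type*} (s : Finset ι) {f : ι → ℝ → ℂ}
    (hf : ∀ i ∈ s, Continuous (f i)) (h : ∀ i ∈ s, ∀ j ∈ s, i ≠ j →
      ∫ t in (0 : ℝ)..(2 * π), f i t * (starRingEnd ℂ) (f j t) = 0) :
    ∫ t in (0 : ℝ)..(2 * π), ‖∑ i ∈ s, f i t‖ ^ 2 =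
      ∑ i ∈ s, ∫ t in (0 : ℝ)..(2 * π), ‖f i t‖ ^ 2 := by
  have hconj := Complex.continuous_conj
  have hint : ∀ i ∈ s, ∀ j ∈ s, IntervalIntegrable
      (fun t => f i t * (starRingEnd ℂ) (f j t)) volume 0 (2 * π) := fun i hi j hj =>
    ((hf i hi).mul (hconj.comp (hf j hj))).intervalIntegrable _ _
  have hint2 : ∀ i ∈ s, IntervalIntegrable
      (fun t => ∑ j ∈ s, f i t * (starRingEnd ℂ) (f j t)) volume 0 (2 * π) := fun i hi =>
    Continuous.intervalIntegrable
      (continuous_finsetSum s fun j hj => (hf i hi).mul (hconj.comp (hf j hj))) _ _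
  have key : ((∫ t in (0 : ℝ)..(2 * π), ‖∑ i ∈ s, f i t‖ ^ 2 : ℝ) : ℂ) =
      ((∑ i ∈ s, ∫ t in (0 : ℝ)..(2 * π), ‖f i t‖ ^ 2 : ℝ) : ℂ) := by
    rw [integral_norm_sq_eq]
    simp only [map_sum, Finset.sum_mul_sum]
    rw [intervalIntegral.integral_finsetSum hint2]
    push_cast
    refine Finset.sum_congr rfl fun i hi => ?_
    rw [intervalIntegral.integral_finsetSum fun j hj => hint i hi j hj,
      Finset.sum_eq_single_of_mem i hi fun j hj hji => h i hi j hj hji.symm, integral_norm_sq_eq]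
  exact_mod_cast key

/-- If `H = -d²/dx² + a`, then a sum of eigenfunctions of `H` to eigenvalues close to `c` has
no nontrivial zero combination missing the frequencies where `k²` is close to `c`. -/
theorem hillSpace_sum_eq_zero {a : ℝ → ℝ} (ha : Continuous a) {α : ℝ} (hα : ∀ x, |a x| ≤ α)
    {s : Finset ℝ} {S : Set ℤ} {c C d : ℝ} (hd : 0 ≤ d) (hs : ∀ l ∈ s, |l - c| ≤ C)
    (hS : ∀ k ∉ S, d ≤ |(k : ℝ) ^ 2 - c|) (hlt : 2 * C ^ 2 + 2 * α ^ 2 < d ^ 2)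
    {w : ℝ → ℝ → ℂ} (hw : ∀ l ∈ s, w l ∈ hillSpace a l)
    (h0 : ∀ k ∈ S, ∑ l ∈ s, circleCoeff (w l) k = 0) : ∀ l ∈ s, w l = 0 := by
  have hwc : ∀ l ∈ s, Continuous (w l) := fun l hl => hillSpace.continuous (hw l hl)
  have hex : ∀ l, ∃ v : ℝ → ℂ, l ∈ s → (∀ x, HasDerivAt (w l) (v x) x) ∧
      ∀ x, HasDerivAt v (((a x : ℂ) - l) * w l x) x := fun l => by
    by_cases hl : l ∈ s
    · obtain ⟨-, v, h1, h2⟩ := hw l hl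
      exact ⟨v, fun _ => ⟨h1, h2⟩⟩
    · exact ⟨0, fun h => absurd h hl⟩
  choose v hv using hex
  set u : ℝ → ℂ := fun x => ∑ l ∈ s, w l x with hu
  have huc : Continuous u := continuous_finsetSum s hwc
  have hup : Function.Periodic u (2 * π) := fun x =>
    Finset.sum_congr rfl fun l hl => (hw l hl).1 x
  have huv : ∀ x, HasDerivAt u (∑ l ∈ s, v l x) x := fun x =>
    HasDerivAt.fun_sum fun l hl => (hv l hl).1 x
  have hvw : ∀ x, HasDerivAt (fun x => ∑ l ∈ s, v l x) (∑ l ∈ s, ((a x : ℂ) - l) * w l x) x :=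
    fun x => HasDerivAt.fun_sum fun l hl => (hv l hl).2 x
  have hgap := le_integral_norm_sq_of_circleCoeff_eq_zero hup huv hvw
    (continuous_finsetSum s fun l hl => by have := hwc l hl; fun_prop) hd hS (fun k hk => by
      rw [← h0 k hk]
      simp only [circleCoeff, hu, Finset.mul_sum]
      rw [intervalIntegral.integral_finsetSum fun l hl => by
        have := hwc l hl
        exact Continuous.intervalIntegrable (by fun_prop) _ _])
  -- Here `u'' + c u = h + a u`. Orthogonality of the `w l` gives `‖h‖² ≤ C² ‖u‖²`, with the squared
  -- coefficients `(c - l)² ≤ C²`.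
  set h : ℝ → ℂ := fun x => ∑ l ∈ s, ((c - l : ℝ) : ℂ) * w l x with hh
  have hhc : Continuous h := continuous_finsetSum s fun l hl => by have := hwc l hl; fun_prop
  have horth : ∀ i ∈ s, ∀ j ∈ s, i ≠ j →
      ∫ t in (0 : ℝ)..(2 * π), w i t * (starRingEnd ℂ) (w j t) = 0 := fun i hi j hj hij =>
    hillSpace_orthogonal (by rw [Complex.conj_ofReal]; exact_mod_cast hij.symm)
      (hw i hi) (hw j hj)
  have hnorm_h : ∫ t in (0 : ℝ)..(2 * π), ‖h t‖ ^ 2 ≤ C ^ 2 * ∫ t in (0 : ℝ)..(2 * π), ‖u t‖ ^ 2 := by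
    rw [hh, hu, integral_norm_sq_sum s hwc horth, integral_norm_sq_sum s
      (fun l hl => by have := hwc l hl; fun_prop) (fun i hi j hj hij => ?_), Finset.mul_sum]
    · refine Finset.sum_le_sum fun l hl => ?_
      simp only [norm_mul, mul_pow, intervalIntegral.integral_const_mul, Complex.norm_real]
      refine mul_le_mul_of_nonneg_right ?_
        (intervalIntegral.integral_nonneg Real.two_pi_pos.le fun _ _ => by positivity)
      rw [Real.norm_eq_abs, abs_sub_comm]
      exact pow_le_pow_left₀ (abs_nonneg _) (hs l hl) 2
    · have : ∀ t, ((c - i : ℝ) : ℂ) * w i t * (starRingEnd ℂ) (((c - j : ℝ) : ℂ) * w j t) =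
          (((c - i) * (c - j) : ℝ) : ℂ) * (w i t * (starRingEnd ℂ) (w j t)) := fun t => by
        simp only [map_mul, Complex.conj_ofReal]; push_cast; ring
      simp only [this, intervalIntegral.integral_const_mul, horth i hi j hj hij, mul_zero]
  have hle : ∫ t in (0 : ℝ)..(2 * π), ‖(∑ l ∈ s, ((a t : ℂ) - l) * w l t) + c * u t‖ ^ 2 ≤
      2 * (∫ t in (0 : ℝ)..(2 * π), ‖h t‖ ^ 2) + 2 * α ^ 2 * ∫ t in (0 : ℝ)..(2 * π), ‖u t‖ ^ 2 := by
    rw [← intervalIntegral.integral_const_mul, ← intervalIntegral.integral_const_mul,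
      ← intervalIntegral.integral_add (Continuous.intervalIntegrable (by fun_prop) _ _)
        (Continuous.intervalIntegrable (by fun_prop) _ _)]
    refine intervalIntegral.integral_mono_on Real.two_pi_pos.le ?_
      (Continuous.intervalIntegrable (by fun_prop) _ _) fun t _ => ?_
    · refine Continuous.intervalIntegrable ?_ _ _
      have : Continuous fun t => ∑ l ∈ s, ((a t : ℂ) - l) * w l t :=
        continuous_finsetSum s fun l hl => by have := hwc l hl; fun_prop
      fun_prop
    · have e : (∑ l ∈ s, ((a t : ℂ) - l) * w l t) + c * u t = h t + a t * u t := by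
        simp only [hh, hu, Finset.mul_sum, ← Finset.sum_add_distrib]
        exact Finset.sum_congr rfl fun l _ => by push_cast; ring
      have e2 : ‖(a t : ℂ) * u t‖ ≤ α * ‖u t‖ := by
        rw [norm_mul, Complex.norm_real, Real.norm_eq_abs]
        exact mul_le_mul_of_nonneg_right (hα t) (norm_nonneg _)
      rw [e]
      have e3 := norm_add_le (h t) (a t * u t)
      have e4 : ‖h t + a t * u t‖ ^ 2 ≤ (‖h t‖ + α * ‖u t‖) ^ 2 :=
        pow_le_pow_left₀ (norm_nonneg _) (by linarith) 2
      nlinarith [sq_nonneg (‖h t‖ - α * ‖u t‖)]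
  -- The gap gives `d² ‖u‖² ≤ (2 C² + 2 α²) ‖u‖²`, which forces `u = 0`. By Pythagoras every summand
  -- then vanishes.
  have hu0 : ∫ t in (0 : ℝ)..(2 * π), ‖u t‖ ^ 2 ≤ 0 := by
    by_contra hpos
    push Not at hpos
    nlinarith [mul_lt_mul_of_pos_right hlt hpos]
  intro l hl
  refine eq_zero_of_integral_norm_sq (hwc l hl) (hw l hl).1 ?_
  refine le_trans ?_ hu0
  rw [hu, integral_norm_sq_sum s hwc horth]
  exact Finset.single_le_sum (f := fun l => ∫ t in (0 : ℝ)..(2 * π), ‖w l t‖ ^ 2)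
    (fun i _ => intervalIntegral.integral_nonneg Real.two_pi_pos.le fun _ _ => by positivity) hl

/-- The Fourier coefficient as a linear functional on a space of eigenfunctions. -/
noncomputable def hillCoeff (a : ℝ → ℝ) (z : ℂ) (k : ℤ) : hillSpace a z →ₗ[ℂ] ℂ where
  toFun u := circleCoeff u.1 k
  map_add' u v := by
    have h1 := hillSpace.continuous u.2
    have h2 := hillSpace.continuous v.2
    simp only [circleCoeff, Submodule.coe_add, Pi.add_apply, mul_add]
    exact intervalIntegral.integral_add (Continuous.intervalIntegrable (by fun_prop) _ _)
        (Continuous.intervalIntegrable (by fun_prop) _ _)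
  map_smul' c u := by
    simp only [circleCoeff, Submodule.coe_smul, Pi.smul_apply, smul_eq_mul, RingHom.id_apply,
      ← intervalIntegral.integral_const_mul]
    exact intervalIntegral.integral_congr fun t _ => by ring

/-- The map `T` sends a family of eigenfunctions to the coefficients in `S` of its sum. By
`hillSpace_sum_eq_zero` it is injective, so the total dimension is at most that of `ℂ^S`. All upper
counts below are instances of this with suitable `c`, `C`, `d`, `S`. -/
theorem sum_finrank_hillSpace_le {a : ℝ → ℝ} (ha : Continuous a) {α : ℝ} (hα : ∀ x, |a x| ≤ α)
    {s : Finset ℝ} {S : Finset ℤ} {c C d : ℝ} (hd : 0 ≤ d) (hs : ∀ l ∈ s, |l - c| ≤ C)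
    (hS : ∀ k ∉ S, d ≤ |(k : ℝ) ^ 2 - c|) (hlt : 2 * C ^ 2 + 2 * α ^ 2 < d ^ 2) :
    (∀ l ∈ s, FiniteDimensional ℂ (hillSpace a l)) ∧
      ∑ l ∈ s, Module.finrank ℂ (hillSpace a l) ≤ S.card := by
  classical
  let T : ((l : s) → hillSpace a (l.1 : ℂ)) →ₗ[ℂ] (S → ℂ) :=
    LinearMap.pi fun k => ∑ l : s, (hillCoeff a l.1 k.1) ∘ₗ LinearMap.proj l
  have hT : Function.Injective T := by
    rw [← LinearMap.ker_eq_bot, LinearMap.ker_eq_bot']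
    intro w hw
    have key := hillSpace_sum_eq_zero ha hα (S := (S : Set ℤ)) hd hs (by simpa using hS) hlt
      (w := fun l => if hl : l ∈ s then (w ⟨l, hl⟩).1 else 0)
      (fun l hl => by simp only [hl, dif_pos]; exact (w ⟨l, hl⟩).2) (fun k hk => by
        have h1 := congrFun hw ⟨k, hk⟩
        simp only [T, LinearMap.pi_apply, LinearMap.sum_apply, LinearMap.comp_apply,
          LinearMap.proj_apply, Pi.zero_apply] at h1
        rw [← h1, ← Finset.sum_attach]
        refine Finset.sum_congr rfl fun l _ => ?_
        simp only [l.2, dif_pos]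
        rfl)
    funext l
    have := key l.1 l.2
    simp only [l.2, dif_pos] at this
    exact Subtype.ext this
  have hfin : FiniteDimensional ℂ ((l : s) → hillSpace a (l.1 : ℂ)) :=
    FiniteDimensional.of_injective T hT
  have hfd : ∀ l : s, FiniteDimensional ℂ (hillSpace a (l.1 : ℂ)) := fun l =>
    FiniteDimensional.of_injective (LinearMap.single ℂ (fun l : s => hillSpace a (l.1 : ℂ)) l)
      (Pi.single_injective (M := fun l : s => hillSpace a (l.1 : ℂ)) l)
  refine ⟨fun l hl => hfd ⟨l, hl⟩, ?_⟩
  have h1 := LinearMap.finrank_le_finrank_of_injective hT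
  rw [Module.finrank_pi_fintype, Module.finrank_fintype_fun_eq_card, Fintype.card_coe] at h1
  rw [← Finset.sum_attach]
  exact h1

/-! ### Variation of constants and the symmetric Green operator -/

noncomputable def cosPrim (ω : ℝ) (f : ℝ → ℝ) (x : ℝ) : ℝ := ∫ t in (0 : ℝ)..x, Real.cos (ω * t) * f t

noncomputable def sinPrim (ω : ℝ) (f : ℝ → ℝ) (x : ℝ) : ℝ := ∫ t in (0 : ℝ)..x, Real.sin (ω * t) * f t

theorem hasDerivAt_cosPrim (ω : ℝ) {f : ℝ → ℝ} (hf : Continuous f) (x : ℝ) :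
    HasDerivAt (cosPrim ω f) (Real.cos (ω * x) * f x) x :=
  hasDerivAt_primitive (f := fun t => Real.cos (ω * t) * f t) (by fun_prop) x

theorem hasDerivAt_sinPrim (ω : ℝ) {f : ℝ → ℝ} (hf : Continuous f) (x : ℝ) :
    HasDerivAt (sinPrim ω f) (Real.sin (ω * x) * f x) x :=
  hasDerivAt_primitive (f := fun t => Real.sin (ω * t) * f t) (by fun_prop) x

theorem hasDerivAt_cos_mul (ω x : ℝ) :
    HasDerivAt (fun t => Real.cos (ω * t)) (-(ω * Real.sin (ω * x))) x := by
  refine ((hasDerivAt_id x).const_mul ω).cos.congr_deriv ?_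
  simp only [id]; ring

theorem hasDerivAt_sin_mul (ω x : ℝ) :
    HasDerivAt (fun t => Real.sin (ω * t)) (ω * Real.cos (ω * x)) x := by
  refine ((hasDerivAt_id x).const_mul ω).sin.congr_deriv ?_
  simp only [id]; ring

/-- The solution of `w'' + ω² w = f` with vanishing Cauchy data at `0`. -/
noncomputable def duhamel (ω : ℝ) (f : ℝ → ℝ) (x : ℝ) : ℝ :=
  (Real.sin (ω * x) * cosPrim ω f x - Real.cos (ω * x) * sinPrim ω f x) / ω

noncomputable def duhamelDeriv (ω : ℝ) (f : ℝ → ℝ) (x : ℝ) : ℝ :=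
  Real.cos (ω * x) * cosPrim ω f x + Real.sin (ω * x) * sinPrim ω f x

theorem hasDerivAt_duhamel {ω : ℝ} (hω : ω ≠ 0) {f : ℝ → ℝ} (hf : Continuous f) (x : ℝ) :
    HasDerivAt (duhamel ω f) (duhamelDeriv ω f x) x := by
  refine ((((hasDerivAt_sin_mul ω x).mul (hasDerivAt_cosPrim ω hf x)).sub
    ((hasDerivAt_cos_mul ω x).mul (hasDerivAt_sinPrim ω hf x))).div_const ω).congr_deriv ?_
  simp only [duhamelDeriv]
  field_simp
  ring

theorem hasDerivAt_duhamelDeriv {ω : ℝ} {f : ℝ → ℝ} (hf : Continuous f) (x : ℝ) :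
    HasDerivAt (duhamelDeriv ω f) (f x - ω ^ 2 * duhamel ω f x) x := by
  refine (((hasDerivAt_cos_mul ω x).mul (hasDerivAt_cosPrim ω hf x)).add
    ((hasDerivAt_sin_mul ω x).mul (hasDerivAt_sinPrim ω hf x))).congr_deriv ?_
  simp only [duhamel]
  field_simp
  linear_combination f x * Real.sin_sq_add_cos_sq (ω * x)

theorem abs_cosPrim_le (ω : ℝ) {f : ℝ → ℝ} {B x : ℝ} (hx : x ∈ Icc 0 (2 * π))
    (hB : ∀ t ∈ Icc 0 (2 * π), |f t| ≤ B) : |cosPrim ω f x| ≤ 2 * π * B := by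
  have hB0 : 0 ≤ B := (abs_nonneg _).trans (hB x hx)
  have h := intervalIntegral.norm_integral_le_of_norm_le_const (a := 0) (b := x) (C := B)
    (f := fun t => Real.cos (ω * t) * f t) fun t ht => by
      rw [uIoc_of_le hx.1] at ht
      rw [norm_mul, Real.norm_eq_abs, Real.norm_eq_abs]
      have h1 := hB t ⟨ht.1.le, ht.2.trans hx.2⟩
      nlinarith [Real.abs_cos_le_one (ω * t), abs_nonneg (f t)]
  rw [sub_zero, abs_of_nonneg hx.1, Real.norm_eq_abs] at h
  rw [cosPrim]
  nlinarith [hx.2]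

theorem abs_sinPrim_le (ω : ℝ) {f : ℝ → ℝ} {B x : ℝ} (hx : x ∈ Icc 0 (2 * π))
    (hB : ∀ t ∈ Icc 0 (2 * π), |f t| ≤ B) : |sinPrim ω f x| ≤ 2 * π * B := by
  have hB0 : 0 ≤ B := (abs_nonneg _).trans (hB x hx)
  have h := intervalIntegral.norm_integral_le_of_norm_le_const (a := 0) (b := x) (C := B)
    (f := fun t => Real.sin (ω * t) * f t) fun t ht => by
      rw [uIoc_of_le hx.1] at ht
      rw [norm_mul, Real.norm_eq_abs, Real.norm_eq_abs]
      have h1 := hB t ⟨ht.1.le, ht.2.trans hx.2⟩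
      nlinarith [Real.abs_sin_le_one (ω * t), abs_nonneg (f t)]
  rw [sub_zero, abs_of_nonneg hx.1, Real.norm_eq_abs] at h
  rw [sinPrim]
  nlinarith [hx.2]

/-- The convolution of `f` on `[0, 2π]` with the even fundamental solution `sin (ω |x|) / (2 ω)`
of `d²/dx² + ω²`. -/
noncomputable def green (ω : ℝ) (f : ℝ → ℝ) (x : ℝ) : ℝ :=
  duhamel ω f x + (Real.cos (ω * x) * sinPrim ω f (2 * π)
    - Real.sin (ω * x) * cosPrim ω f (2 * π)) / (2 * ω)

theorem continuous_green {ω : ℝ} (hω : ω ≠ 0) {f : ℝ → ℝ} (hf : Continuous f) :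
    Continuous (green ω f) := by
  have : Continuous (duhamel ω f) :=
    continuous_iff_continuousAt.2 fun x => (hasDerivAt_duhamel hω hf x).continuousAt
  unfold green
  fun_prop

theorem abs_mul_sub_mul_le {x y s t B : ℝ} (hs : |s| ≤ 1) (ht : |t| ≤ 1) (hx : |x| ≤ B)
    (hy : |y| ≤ B) : |s * x - t * y| ≤ 2 * B := by
  have h1 : |s * x| ≤ B := by rw [abs_mul]; nlinarith [abs_nonneg x, abs_nonneg s]
  have h2 : |t * y| ≤ B := by rw [abs_mul]; nlinarith [abs_nonneg y, abs_nonneg t]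
  linarith [abs_sub (s * x) (t * y)]

theorem abs_duhamel_le {ω : ℝ} (hω : 0 < ω) {f : ℝ → ℝ} {B x : ℝ} (hx : x ∈ Icc 0 (2 * π))
    (hB : ∀ t ∈ Icc 0 (2 * π), |f t| ≤ B) : |duhamel ω f x| ≤ 4 * π * B / ω := by
  rw [duhamel, abs_div, abs_of_pos hω]
  gcongr
  have := abs_mul_sub_mul_le (Real.abs_sin_le_one (ω * x)) (Real.abs_cos_le_one (ω * x))
    (abs_cosPrim_le ω hx hB) (abs_sinPrim_le ω hx hB)
  linarith

theorem abs_green_le {ω : ℝ} (hω : 0 < ω) {f : ℝ → ℝ} {B x : ℝ} (hx : x ∈ Icc 0 (2 * π))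
    (hB : ∀ t ∈ Icc 0 (2 * π), |f t| ≤ B) : |green ω f x| ≤ 6 * π * B / ω := by
  have h2π : 2 * π ∈ Icc 0 (2 * π) := ⟨Real.two_pi_pos.le, le_rfl⟩
  have h1 := abs_duhamel_le hω hx hB
  have h2 := abs_mul_sub_mul_le (Real.abs_cos_le_one (ω * x)) (Real.abs_sin_le_one (ω * x))
    (abs_sinPrim_le ω h2π hB) (abs_cosPrim_le ω h2π hB)
  have h3 : |(Real.cos (ω * x) * sinPrim ω f (2 * π)
    - Real.sin (ω * x) * cosPrim ω f (2 * π)) / (2 * ω)| ≤ 2 * (2 * π * B) / (2 * ω) := by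
    rw [abs_div, abs_of_pos (by positivity : 0 < 2 * ω)]
    gcongr
  calc |green ω f x| ≤ 4 * π * B / ω + 2 * (2 * π * B) / (2 * ω) := (abs_add_le _ _).trans (add_le_add h1 h3)
    _ = 6 * π * B / ω := by field_simp; ring

theorem cosPrim_congr {ω : ℝ} {f g : ℝ → ℝ} {x : ℝ} (hx : x ∈ Icc 0 (2 * π))
    (h : ∀ t ∈ Icc 0 (2 * π), f t = g t) : cosPrim ω f x = cosPrim ω g x :=
  intervalIntegral.integral_congr fun t ht => by
    rw [uIcc_of_le hx.1] at ht
    simp only [h t ⟨ht.1, ht.2.trans hx.2⟩]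

theorem sinPrim_congr {ω : ℝ} {f g : ℝ → ℝ} {x : ℝ} (hx : x ∈ Icc 0 (2 * π))
    (h : ∀ t ∈ Icc 0 (2 * π), f t = g t) : sinPrim ω f x = sinPrim ω g x :=
  intervalIntegral.integral_congr fun t ht => by
    rw [uIcc_of_le hx.1] at ht
    simp only [h t ⟨ht.1, ht.2.trans hx.2⟩]

theorem green_congr {ω : ℝ} {f g : ℝ → ℝ} {x : ℝ} (hx : x ∈ Icc 0 (2 * π))
    (h : ∀ t ∈ Icc 0 (2 * π), f t = g t) : green ω f x = green ω g x := by
  have h2π : 2 * π ∈ Icc 0 (2 * π) := ⟨Real.two_pi_pos.le, le_rfl⟩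
  simp only [green, duhamel, cosPrim_congr hx h, sinPrim_congr hx h, cosPrim_congr h2π h,
    sinPrim_congr h2π h]

theorem cosPrim_add {ω : ℝ} {f g : ℝ → ℝ} (hf : Continuous f) (hg : Continuous g) (x : ℝ) :
    cosPrim ω (fun t => f t + g t) x = cosPrim ω f x + cosPrim ω g x := by
  simp only [cosPrim, mul_add]
  exact intervalIntegral.integral_add (Continuous.intervalIntegrable (by fun_prop) _ _)
    (Continuous.intervalIntegrable (by fun_prop) _ _)

theorem sinPrim_add {ω : ℝ} {f g : ℝ → ℝ} (hf : Continuous f) (hg : Continuous g) (x : ℝ) :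
    sinPrim ω (fun t => f t + g t) x = sinPrim ω f x + sinPrim ω g x := by
  simp only [sinPrim, mul_add]
  exact intervalIntegral.integral_add (Continuous.intervalIntegrable (by fun_prop) _ _)
    (Continuous.intervalIntegrable (by fun_prop) _ _)

theorem cosPrim_const_mul {ω : ℝ} (c : ℝ) (f : ℝ → ℝ) (x : ℝ) :
    cosPrim ω (fun t => c * f t) x = c * cosPrim ω f x := by
  simp only [cosPrim, mul_left_comm _ c]
  exact intervalIntegral.integral_const_mul _ _

theorem sinPrim_const_mul {ω : ℝ} (c : ℝ) (f : ℝ → ℝ) (x : ℝ) :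
    sinPrim ω (fun t => c * f t) x = c * sinPrim ω f x := by
  simp only [sinPrim, mul_left_comm _ c]
  exact intervalIntegral.integral_const_mul _ _

theorem green_add {ω : ℝ} {f g : ℝ → ℝ} (hf : Continuous f) (hg : Continuous g) (x : ℝ) :
    green ω (fun t => f t + g t) x = green ω f x + green ω g x := by
  simp only [green, duhamel, cosPrim_add hf hg, sinPrim_add hf hg]
  ring

theorem green_const_mul {ω : ℝ} (c : ℝ) (f : ℝ → ℝ) (x : ℝ) :
    green ω (fun t => c * f t) x = c * green ω f x := by
  simp only [green, duhamel, cosPrim_const_mul, sinPrim_const_mul]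
  ring

/-- The kernel `sin (ω |x - t|) / (2 ω)` is symmetric. This is the reason to work with `green`
instead of `duhamel`: it makes the reduced 2×2 matrix symmetric. -/
theorem integral_green_mul {ω : ℝ} (hω : ω ≠ 0) {f g : ℝ → ℝ} (hf : Continuous f)
    (hg : Continuous g) : ∫ x in (0 : ℝ)..(2 * π), green ω f x * g x =
      ∫ x in (0 : ℝ)..(2 * π), f x * green ω g x := by
  have hcf := continuous_green hω hf
  have hcg := continuous_green hω hg
  rw [← sub_eq_zero, ← intervalIntegral.integral_sub
    (Continuous.intervalIntegrable (by fun_prop) _ _)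
    (Continuous.intervalIntegrable (by fun_prop) _ _)]
  -- An explicit antiderivative of the integrand replaces Fubini's theorem; it vanishes at both `0`
  -- and `2π`.
  have key : ∀ x, HasDerivAt (fun x => (sinPrim ω g x * cosPrim ω f x - cosPrim ω g x * sinPrim ω f x
      + (cosPrim ω g x * sinPrim ω f (2 * π) - sinPrim ω g x * cosPrim ω f (2 * π)
        - cosPrim ω f x * sinPrim ω g (2 * π) + sinPrim ω f x * cosPrim ω g (2 * π)) / 2) / ω)
      (green ω f x * g x - f x * green ω g x) x := fun x => by
    have cf := hasDerivAt_cosPrim ω hf x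
    have sf := hasDerivAt_sinPrim ω hf x
    have cg := hasDerivAt_cosPrim ω hg x
    have sg := hasDerivAt_sinPrim ω hg x
    refine ((((sg.mul cf).sub (cg.mul sf)).add
      (((((cg.mul_const _).sub (sg.mul_const _)).sub (cf.mul_const _)).add
        (sf.mul_const _)).div_const 2)).div_const ω).congr_deriv ?_
    simp only [green, duhamel]
    field_simp
    ring
  rw [intervalIntegral.integral_eq_sub_of_hasDerivAt (fun x _ => key x)
    (Continuous.intervalIntegrable (by fun_prop) _ _)]
  simp only [cosPrim, sinPrim, intervalIntegral.integral_same]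
  ring

/-- A function on a period that solves the integral equation, subject to the two orthogonality
conditions, extends to a periodic solution of Hill's equation. -/
theorem exists_periodic_solution {a : ℝ → ℝ} (ha : Continuous a) (hap : Function.Periodic a (2 * π))
    {n : ℕ} (hn : n ≠ 0) {μ x y : ℝ} {w : ℝ → ℝ} (hw : Continuous w)
    (hsol : ∀ t ∈ Icc 0 (2 * π), w t = x * Real.cos (n * t) + y * Real.sin (n * t)
      + green n (fun t => (a t - μ) * w t) t)
    (hc : cosPrim n (fun t => (a t - μ) * w t) (2 * π) = 0)
    (hs : sinPrim n (fun t => (a t - μ) * w t) (2 * π) = 0) :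
    ∃ W V : ℝ → ℝ, Function.Periodic W (2 * π) ∧ (∀ t, HasDerivAt W (V t) t) ∧
      (∀ t, HasDerivAt V ((a t - ((n : ℝ) ^ 2 + μ)) * W t) t) ∧ ∀ t ∈ Icc 0 (2 * π), W t = w t := by
  have hn' : (n : ℝ) ≠ 0 := by exact_mod_cast hn
  have h2π : 2 * π ∈ Icc 0 (2 * π) := ⟨Real.two_pi_pos.le, le_rfl⟩
  have h0 : (0 : ℝ) ∈ Icc 0 (2 * π) := ⟨le_rfl, Real.two_pi_pos.le⟩
  have hcosp : ∀ t : ℝ, Real.cos (n * (t + 2 * π)) = Real.cos (n * t) := fun t => by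
    rw [mul_add, Real.cos_add_nat_mul_two_pi]
  have hsinp : ∀ t : ℝ, Real.sin (n * (t + 2 * π)) = Real.sin (n * t) := fun t => by
    rw [mul_add, Real.sin_add_nat_mul_two_pi]
  have hend : w (2 * π) = w 0 := by
    rw [hsol _ h2π, hsol _ h0]
    have e1 := hcosp 0
    have e2 := hsinp 0
    rw [zero_add] at e1 e2
    simp only [green, duhamel, hc, hs, e1, e2]
    simp [cosPrim, sinPrim]
  -- The integral equation is only known on one period, so `w` is extended periodically. Continuity
  -- of `P` rests on `hend`, which holds because the two orthogonality conditions kill the Duhamel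
  -- term at `2π`.
  set P : ℝ → ℝ := fun t => w (toIcoMod Real.two_pi_pos 0 t) with hP
  have hPp : Function.Periodic P (2 * π) := fun t => by
    simp only [hP, toIcoMod_add_right]
  have hPw : ∀ t ∈ Icc 0 (2 * π), P t = w t := fun t ht => by
    rcases eq_or_lt_of_le ht.2 with rfl | hlt
    · have h := hPp 0
      rw [zero_add] at h
      rw [h, hend]
      simp only [hP]
      rw [(toIcoMod_eq_self Real.two_pi_pos).2 (by simpa using Real.pi_pos)]
    · simp only [hP]
      rw [(toIcoMod_eq_self Real.two_pi_pos).2 (by simpa using ⟨ht.1, hlt⟩)]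
  have hPc : Continuous P := continuous_of_periodic_of_continuousOn Real.two_pi_pos hPp
    (hw.continuousOn.congr hPw)
  set F : ℝ → ℝ := fun t => (a t - μ) * P t with hF
  have hFc : Continuous F := by fun_prop
  have hFw : ∀ t ∈ Icc 0 (2 * π), (fun t => (a t - μ) * w t) t = F t := fun t ht => by
    simp only [hF, hPw t ht]
  rw [cosPrim_congr h2π hFw] at hc
  rw [sinPrim_congr h2π hFw] at hs
  have hFp : ∀ t, F (t + 2 * π) = F t := fun t => by simp only [hF, hap t, hPp t]
  set W : ℝ → ℝ := fun t => x * Real.cos (n * t) + y * Real.sin (n * t) + duhamel n F t with hW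
  have hWw : ∀ t ∈ Icc 0 (2 * π), W t = w t := fun t ht => by
    rw [hsol t ht, green_congr ht hFw, green, hc, hs]
    simp [hW]
  have hcp : ∀ t, cosPrim n F (t + 2 * π) = cosPrim n F t := fun t => by
    have := primitive_add_period (f := fun t => Real.cos (n * t) * F t) (T := 2 * π) (by fun_prop)
      (fun t => by simp only [hcosp, hFp]) t
    simp only [cosPrim] at hc ⊢
    rw [this, hc, add_zero]
  have hsp : ∀ t, sinPrim n F (t + 2 * π) = sinPrim n F t := fun t => by
    have := primitive_add_period (f := fun t => Real.sin (n * t) * F t) (T := 2 * π) (by fun_prop)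
      (fun t => by simp only [hsinp, hFp]) t
    simp only [sinPrim] at hs ⊢
    rw [this, hs, add_zero]
  have hWp : Function.Periodic W (2 * π) := fun t => by
    simp only [hW, duhamel, hcosp, hsinp, hcp, hsp]
  -- Under the orthogonality conditions `green` and `duhamel` agree on the period and `W` is
  -- periodic, so `W` equals `P` everywhere. Hence the forcing `F` is `(a - μ) W` itself.
  have hWP : W = P := eq_of_periodic_of_eqOn Real.two_pi_pos hWp hPp fun t ht => by
    rw [hWw t ht, hPw t ht]
  refine ⟨W, fun t => x * -(n * Real.sin (n * t)) + y * (n * Real.cos (n * t)) + duhamelDeriv n F t,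
    hWp, fun t => ?_, fun t => ?_, hWw⟩
  · exact (((hasDerivAt_cos_mul n t).const_mul x).add ((hasDerivAt_sin_mul n t).const_mul y)).add
      (hasDerivAt_duhamel hn' hFc t)
  · refine ((((((hasDerivAt_sin_mul n t).const_mul (n : ℝ)).neg).const_mul x).add
      (((hasDerivAt_cos_mul n t).const_mul (n : ℝ)).const_mul y)).add
      (hasDerivAt_duhamelDeriv hFc t)).congr_deriv ?_
    have e : F t = (a t - μ) * W t := by rw [hWP]
    rw [e]
    simp only [hW]
    ring

/-- A continuous family of symmetric matrices that goes from positive to negative definite is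
singular twice. -/
theorem exists_two_singular {p q r : ℝ → ℝ} {s t : ℝ} (hst : s ≤ t) (hp : ContinuousOn p (Icc s t))
    (hq : ContinuousOn q (Icc s t)) (hr : ContinuousOn r (Icc s t)) (hs : |q s| < p s)
    (hs' : |q s| < r s) (ht : |q t| < -p t) (ht' : |q t| < -r t) :
    ∃ x ∈ Icc s t, ∃ y ∈ Icc s t, p x * r x = q x ^ 2 ∧ p y * r y = q y ^ 2 ∧
      (x = y → p x = 0 ∧ q x = 0 ∧ r x = 0) := by
  -- The difference of the two eigenvalues of the matrix with diagonal `p`, `r` and off-diagonal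
  -- entry `q`; thus `p + r - D` and `p + r + D` are twice these eigenvalues. Diagonal dominance
  -- makes both positive at `s` and negative at `t`. If both vanish at one point, then `D = 0` and
  -- `p + r = 0`, so the matrix is zero there.
  set D : ℝ → ℝ := fun x => √((p x - r x) ^ 2 + 4 * q x ^ 2) with hD
  have hDc : ContinuousOn D (Icc s t) := by
    apply ContinuousOn.sqrt; fun_prop
  have hD2 : ∀ x, D x ^ 2 = (p x - r x) ^ 2 + 4 * q x ^ 2 := fun x => Real.sq_sqrt (by positivity)
  have hD0 : ∀ x, 0 ≤ D x := fun x => Real.sqrt_nonneg _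
  have hsD : D s < p s + r s := by
    refine lt_of_pow_lt_pow_left₀ 2 (by linarith [abs_nonneg (q s)]) ?_
    rw [hD2, ← sq_abs (q s)]
    nlinarith [abs_nonneg (q s), mul_lt_mul'' hs hs' (abs_nonneg _) (abs_nonneg _)]
  have htD : D t < -(p t + r t) := by
    refine lt_of_pow_lt_pow_left₀ 2 (by linarith [abs_nonneg (q t)]) ?_
    rw [hD2, ← sq_abs (q t)]
    nlinarith [abs_nonneg (q t), mul_lt_mul'' ht ht' (abs_nonneg _) (abs_nonneg _)]
  obtain ⟨x, hx, hx0⟩ := intermediate_value_Icc' hst ((hp.add hr).sub hDc)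
    (show (0 : ℝ) ∈ Icc _ _ from ⟨by
      have := hD0 t; simp only [Pi.add_apply, Pi.sub_apply]; linarith, by
      simp only [Pi.add_apply, Pi.sub_apply]; linarith⟩)
  obtain ⟨y, hy, hy0⟩ := intermediate_value_Icc' hst ((hp.add hr).add hDc)
    (show (0 : ℝ) ∈ Icc _ _ from ⟨by
      simp only [Pi.add_apply]; linarith, by
      have := hD0 s; simp only [Pi.add_apply]; linarith⟩)
  simp only [Pi.add_apply, Pi.sub_apply] at hx0 hy0
  refine ⟨x, hx, y, hy, ?_, ?_, ?_⟩
  · have := hD2 x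
    rw [show D x = p x + r x by linarith] at this
    linarith
  · have := hD2 y
    rw [show D y = -(p y + r y) by linarith] at this
    linarith
  · rintro rfl
    have e1 : D x = 0 := by linarith
    have e2 := hD2 x
    rw [e1] at e2
    have e3 : p x - r x = 0 := by nlinarith [sq_nonneg (q x), sq_nonneg (p x - r x)]
    have e4 : q x = 0 := by nlinarith [sq_nonneg (q x), sq_nonneg (p x - r x)]
    exact ⟨by linarith, e4, by linarith⟩

/-! ### The integral equation on the continuous functions of one period -/

/-- The constant-in-the-exterior extension of a function on the period. -/
noncomputable def periodExtend (f : C(Icc (0 : ℝ) (2 * π), ℝ)) : ℝ → ℝ :=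
  IccExtend Real.two_pi_pos.le f

theorem continuous_periodExtend (f : C(Icc (0 : ℝ) (2 * π), ℝ)) : Continuous (periodExtend f) :=
  f.continuous.Icc_extend'

theorem periodExtend_coe (f : C(Icc (0 : ℝ) (2 * π), ℝ)) (x : Icc (0 : ℝ) (2 * π)) :
    periodExtend f x = f x := IccExtend_val _ _ _

theorem abs_periodExtend_le (f : C(Icc (0 : ℝ) (2 * π), ℝ)) (x : ℝ) : |periodExtend f x| ≤ ‖f‖ :=
  f.norm_coe_le_norm _

/-- The bounded operators on the continuous functions on the period. -/
abbrev PeriodOp : Type := C(Icc (0 : ℝ) (2 * π), ℝ) →L[ℝ] C(Icc (0 : ℝ) (2 * π), ℝ)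

/-- The operator `green` on continuous functions on the period. -/
noncomputable def greenOp {n : ℕ} (hn : 0 < n) :
    C(Icc (0 : ℝ) (2 * π), ℝ) →L[ℝ] C(Icc (0 : ℝ) (2 * π), ℝ) :=
  LinearMap.mkContinuous
    { toFun := fun f => ⟨fun x => green n (periodExtend f) x, by
        have := continuous_green (ω := n) (by positivity) (continuous_periodExtend f)
        fun_prop⟩
      map_add' := fun f g => by
        ext x
        exact green_add (continuous_periodExtend f) (continuous_periodExtend g) x
      map_smul' := fun c f => by
        ext x
        exact green_const_mul c (periodExtend f) x }
    (6 * π / n) fun f => by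
      rw [ContinuousMap.norm_le _ (by positivity)]
      intro x
      have := abs_green_le (ω := n) (by positivity) x.2 fun t _ => abs_periodExtend_le f t
      rw [mul_div_right_comm] at this
      exact this

theorem greenOp_apply {n : ℕ} (hn : 0 < n) (f : C(Icc (0 : ℝ) (2 * π), ℝ))
    (x : Icc (0 : ℝ) (2 * π)) : greenOp hn f x = green n (periodExtend f) x := rfl

theorem norm_greenOp_le {n : ℕ} (hn : 0 < n) : ‖greenOp hn‖ ≤ 6 * π / n :=
  LinearMap.mkContinuous_norm_le _ (by positivity) _

/-- Integration over the period. -/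
noncomputable def periodIntegral : C(Icc (0 : ℝ) (2 * π), ℝ) →L[ℝ] ℝ :=
  LinearMap.mkContinuous
    { toFun := fun f => ∫ t in (0 : ℝ)..(2 * π), periodExtend f t
      map_add' := fun f g => intervalIntegral.integral_add
        ((continuous_periodExtend f).intervalIntegrable _ _)
        ((continuous_periodExtend g).intervalIntegrable _ _)
      map_smul' := fun c f => intervalIntegral.integral_const_mul _ _ }
    (2 * π) fun f => by
      have := intervalIntegral.norm_integral_le_of_norm_le_const (a := 0) (b := 2 * π) (C := ‖f‖)
        (f := periodExtend f) fun t _ => abs_periodExtend_le f t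
      rw [sub_zero, abs_of_pos Real.two_pi_pos] at this
      exact this.trans_eq (mul_comm _ _)

theorem periodIntegral_eq {f : C(Icc (0 : ℝ) (2 * π), ℝ)} {g : ℝ → ℝ} (h : ∀ x, f x = g x) :
    periodIntegral f = ∫ t in (0 : ℝ)..(2 * π), g t :=
  intervalIntegral.integral_congr fun t ht => by
    rw [uIcc_of_le Real.two_pi_pos.le] at ht
    exact (periodExtend_coe f ⟨t, ht⟩).trans (h _)

theorem abs_periodIntegral_le (f : C(Icc (0 : ℝ) (2 * π), ℝ)) :
    |periodIntegral f| ≤ 2 * π * ‖f‖ :=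
  (periodIntegral.le_opNorm f).trans (mul_le_mul_of_nonneg_right
    (LinearMap.mkContinuous_norm_le _ Real.two_pi_pos.le _) (norm_nonneg _))

theorem periodIntegral_greenOp_mul {n : ℕ} (hn : 0 < n) (f g : C(Icc (0 : ℝ) (2 * π), ℝ)) :
    periodIntegral (greenOp hn f * g) = periodIntegral (f * greenOp hn g) := by
  have h := integral_green_mul (ω := n) (by positivity) (continuous_periodExtend f)
    (continuous_periodExtend g)
  rw [periodIntegral_eq (g := fun t => green n (periodExtend f) t * periodExtend g t),
    periodIntegral_eq (g := fun t => periodExtend f t * green n (periodExtend g) t), h]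
  · intro x
    simp only [periodExtend_coe, ContinuousMap.mul_apply, greenOp_apply]
  · intro x
    simp only [periodExtend_coe, ContinuousMap.mul_apply, greenOp_apply]

/-- The solution operator of the integral equation `u - G ((a - μ) u) = v` as a function of the
multiplier `b = a - μ`. -/
noncomputable def hillResolvent {n : ℕ} (hn : 0 < n) (b : C(Icc (0 : ℝ) (2 * π), ℝ)) :
    C(Icc (0 : ℝ) (2 * π), ℝ) →L[ℝ] C(Icc (0 : ℝ) (2 * π), ℝ) :=
  Ring.inverse (1 - (greenOp hn).comp (ContinuousLinearMap.mul ℝ _ b))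

theorem norm_greenOp_comp_mul_le {n : ℕ} (hn : 0 < n) (b : C(Icc (0 : ℝ) (2 * π), ℝ)) :
    ‖(greenOp hn).comp (ContinuousLinearMap.mul ℝ _ b)‖ ≤ 6 * π / n * ‖b‖ := by
  refine (ContinuousLinearMap.opNorm_comp_le _ _).trans ?_
  exact mul_le_mul (norm_greenOp_le hn) (ContinuousLinearMap.opNorm_mul_apply_le ℝ _ b)
    (norm_nonneg _) (by positivity)

theorem isUnit_one_sub_greenOp {n : ℕ} (hn : 0 < n) {b : C(Icc (0 : ℝ) (2 * π), ℝ)}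
    (hb : 6 * π / n * ‖b‖ ≤ 1 / 2) :
    IsUnit (1 - (greenOp hn).comp (ContinuousLinearMap.mul ℝ _ b)) :=
  isUnit_one_sub_of_norm_lt_one (R := PeriodOp)
    ((norm_greenOp_comp_mul_le hn b).trans_lt (by linarith))

/-- `Ring.inverse` is `0` off the units; the smallness of `b` ensures invertibility through the
Neumann series. -/
theorem hillResolvent_eq {n : ℕ} (hn : 0 < n) {b : C(Icc (0 : ℝ) (2 * π), ℝ)}
    (hb : 6 * π / n * ‖b‖ ≤ 1 / 2) (v : C(Icc (0 : ℝ) (2 * π), ℝ)) :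
    hillResolvent hn b v = v + greenOp hn (b * hillResolvent hn b v) := by
  have h := congrArg (fun T => T v) (Ring.mul_inverse_cancel _ (isUnit_one_sub_greenOp hn hb))
  simp only [mul_apply_eq_comp, sub_apply, one_apply_eq_self, ContinuousLinearMap.comp_apply,
    ContinuousLinearMap.mul_apply'] at h
  exact sub_eq_iff_eq_add.1 h

theorem norm_hillResolvent_sub_le {n : ℕ} (hn : 0 < n) {b : C(Icc (0 : ℝ) (2 * π), ℝ)}
    (hb : 6 * π / n * ‖b‖ ≤ 1 / 2) {v : C(Icc (0 : ℝ) (2 * π), ℝ)} (hv : ‖v‖ ≤ 1) :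
    ‖hillResolvent hn b v - v‖ ≤ 2 * (6 * π / n * ‖b‖) := by
  have h := hillResolvent_eq hn hb v
  set u := hillResolvent hn b v
  have h1 : ‖greenOp hn (b * u)‖ ≤ 6 * π / n * ‖b‖ * ‖u‖ :=
    ((greenOp hn).comp (ContinuousLinearMap.mul ℝ _ b)).le_of_opNorm_le
      (norm_greenOp_comp_mul_le hn b) u
  have h2 : ‖u‖ ≤ ‖v‖ + ‖greenOp hn (b * u)‖ := by
    calc ‖u‖ = ‖v + greenOp hn (b * u)‖ := by rw [← h]
      _ ≤ _ := norm_add_le _ _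
  -- From `‖u‖ ≤ 1 + ‖u‖ / 2`.
  have h3 : ‖u‖ ≤ 2 := by nlinarith [norm_nonneg u]
  have h4 : u - v = greenOp hn (b * u) := sub_eq_iff_eq_add'.2 h
  rw [h4]
  have : 0 ≤ 6 * π / n * ‖b‖ := by positivity
  nlinarith

/-- Writing `G` for `greenOp`, the operator `b (1 - G b)⁻¹` is symmetric because `G` is: substitute
`v = u - G(b u)` and `w = z - G(b z)` and compare. -/
theorem periodIntegral_hillResolvent_symm {n : ℕ} (hn : 0 < n) {b : C(Icc (0 : ℝ) (2 * π), ℝ)}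
    (hb : 6 * π / n * ‖b‖ ≤ 1 / 2) (v w : C(Icc (0 : ℝ) (2 * π), ℝ)) :
    periodIntegral (v * (b * hillResolvent hn b w)) =
      periodIntegral (w * (b * hillResolvent hn b v)) := by
  have hv := hillResolvent_eq hn hb v
  have hw := hillResolvent_eq hn hb w
  set u := hillResolvent hn b v
  set z := hillResolvent hn b w
  have e1 : v * (b * z) = u * (b * z) - greenOp hn (b * u) * (b * z) := by
    rw [← sub_mul]; congr 1; exact eq_sub_of_add_eq hv.symm
  have e2 : w * (b * u) = u * (b * z) - (b * u) * greenOp hn (b * z) := by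
    have : w = z - greenOp hn (b * z) := eq_sub_of_add_eq hw.symm
    rw [this]; ring
  rw [e1, e2, map_sub, map_sub, periodIntegral_greenOp_mul]

theorem hillResolvent_continuousAt {n : ℕ} (hn : 0 < n) {b : C(Icc (0 : ℝ) (2 * π), ℝ)}
    (hb : 6 * π / n * ‖b‖ ≤ 1 / 2) : ContinuousAt (hillResolvent hn) b := by
  obtain ⟨U, hU⟩ := isUnit_one_sub_greenOp hn hb
  have h := NormedRing.inverse_continuousAt (R := PeriodOp) U
  rw [hU] at h
  refine ContinuousAt.comp (f := fun b => 1 - (greenOp hn).comp (ContinuousLinearMap.mul ℝ _ b)) h ?_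
  have : Continuous fun b => (greenOp hn).comp
    (ContinuousLinearMap.mul ℝ C(Icc (0 : ℝ) (2 * π), ℝ) b) :=
    ((ContinuousLinearMap.compL ℝ _ _ _ (greenOp hn)).continuous).comp
      (ContinuousLinearMap.mul ℝ C(Icc (0 : ℝ) (2 * π), ℝ)).continuous
  exact (continuous_const.sub this).continuousAt

/-! ### Trigonometric integrals for the unperturbed matrix -/

theorem integral_cos_mul_eq_zero {m : ℕ} (hm : m ≠ 0) :
    ∫ t in (0 : ℝ)..(2 * π), Real.cos (m * t) = 0 := by
  have hm' : (m : ℝ) ≠ 0 := by exact_mod_cast hm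
  have h : ∀ x ∈ uIcc 0 (2 * π), HasDerivAt (fun t => Real.sin (m * t) / m) (Real.cos (m * x)) x :=
    fun x _ => ((hasDerivAt_sin_mul m x).div_const _).congr_deriv (by field_simp)
  rw [intervalIntegral.integral_eq_sub_of_hasDerivAt h
    (Continuous.intervalIntegrable (by fun_prop) _ _)]
  have := Real.sin_nat_mul_pi (m * 2)
  push_cast at this
  simp [← mul_assoc, this]

theorem integral_sin_mul_eq_zero {m : ℕ} (hm : m ≠ 0) :
    ∫ t in (0 : ℝ)..(2 * π), Real.sin (m * t) = 0 := by
  have hm' : (m : ℝ) ≠ 0 := by exact_mod_cast hm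
  have h : ∀ x ∈ uIcc 0 (2 * π), HasDerivAt (fun t => -(Real.cos (m * t) / m)) (Real.sin (m * x)) x :=
    fun x _ => ((hasDerivAt_cos_mul m x).div_const _).neg.congr_deriv (by field_simp)
  rw [intervalIntegral.integral_eq_sub_of_hasDerivAt h
    (Continuous.intervalIntegrable (by fun_prop) _ _), Real.cos_nat_mul_two_pi]
  simp

theorem integral_cos_sq_mul {n : ℕ} (hn : n ≠ 0) :
    ∫ t in (0 : ℝ)..(2 * π), Real.cos (n * t) ^ 2 = π := by
  have h : ∀ t : ℝ, Real.cos (n * t) ^ 2 = 1 / 2 + Real.cos ((2 * n : ℕ) * t) / 2 := fun t => by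
    rw [Real.cos_sq]; push_cast; ring_nf
  simp only [h]
  rw [intervalIntegral.integral_add (by simp) (Continuous.intervalIntegrable (by fun_prop) _ _),
    intervalIntegral.integral_div (f := fun t => Real.cos ((2 * n : ℕ) * t)),
    integral_cos_mul_eq_zero (by omega)]
  simp; ring

theorem integral_sin_sq_mul {n : ℕ} (hn : n ≠ 0) :
    ∫ t in (0 : ℝ)..(2 * π), Real.sin (n * t) ^ 2 = π := by
  have h : ∀ t : ℝ, Real.sin (n * t) ^ 2 = 1 - Real.cos (n * t) ^ 2 := fun t => Real.sin_sq _
  simp only [h]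
  rw [intervalIntegral.integral_sub (by simp) (Continuous.intervalIntegrable (by fun_prop) _ _),
    integral_cos_sq_mul hn]
  simp; ring

theorem integral_cos_mul_sin {n : ℕ} (hn : n ≠ 0) :
    ∫ t in (0 : ℝ)..(2 * π), Real.cos (n * t) * Real.sin (n * t) = 0 := by
  have h : ∀ t : ℝ, Real.cos (n * t) * Real.sin (n * t) = Real.sin ((2 * n : ℕ) * t) / 2 := fun t => by
    push_cast
    rw [mul_assoc, Real.sin_two_mul]; ring
  simp only [h]
  rw [intervalIntegral.integral_div, integral_sin_mul_eq_zero (by omega), zero_div]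

/-- The parameter `μ` drops out since `cos nt` and `sin nt` are orthogonal, and `|cos · sin| ≤ 1/2`
saves the factor two that the comparison with the diagonal entries needs. -/
theorem abs_integral_cos_mul_sin_le {a : ℝ → ℝ} (ha : Continuous a) {α : ℝ} (hα : ∀ x, |a x| ≤ α)
    {n : ℕ} (hn : n ≠ 0) (μ : ℝ) :
    |∫ t in (0 : ℝ)..(2 * π), Real.cos (n * t) * ((a t - μ) * Real.sin (n * t))| ≤ π * α := by
  have e : ∀ t, Real.cos (n * t) * ((a t - μ) * Real.sin (n * t)) =
      a t * (Real.cos (n * t) * Real.sin (n * t)) - μ * (Real.cos (n * t) * Real.sin (n * t)) :=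
    fun t => by ring
  simp only [e]
  rw [intervalIntegral.integral_sub (Continuous.intervalIntegrable (by fun_prop) _ _)
    (Continuous.intervalIntegrable (by fun_prop) _ _), intervalIntegral.integral_const_mul,
    integral_cos_mul_sin hn, mul_zero, sub_zero]
  have h := intervalIntegral.norm_integral_le_of_norm_le_const (a := 0) (b := 2 * π) (C := α / 2)
    (f := fun t => a t * (Real.cos (n * t) * Real.sin (n * t))) fun t _ => by
      have h1 : |Real.cos (n * t) * Real.sin (n * t)| ≤ 1 / 2 := by
        rw [abs_le]
        constructor <;> nlinarith [Real.sin_sq_add_cos_sq (n * t),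
          sq_nonneg (Real.cos (n * t) - Real.sin (n * t)),
          sq_nonneg (Real.cos (n * t) + Real.sin (n * t))]
      rw [norm_mul, Real.norm_eq_abs, Real.norm_eq_abs]
      nlinarith [hα t, abs_nonneg (a t), abs_nonneg (Real.cos (n * t) * Real.sin (n * t))]
  rw [sub_zero, abs_of_pos Real.two_pi_pos, Real.norm_eq_abs] at h
  linarith

theorem le_integral_sq_mul {f g : ℝ → ℝ} (hf : Continuous f) (hg : Continuous g)
    (hg2 : ∫ t in (0 : ℝ)..(2 * π), g t ^ 2 = π) {c : ℝ} (hc : ∀ t, c ≤ f t) :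
    c * π ≤ ∫ t in (0 : ℝ)..(2 * π), g t * (f t * g t) := by
  have h0 : c * π = ∫ t in (0 : ℝ)..(2 * π), c * g t ^ 2 := by
    rw [intervalIntegral.integral_const_mul, hg2]
  rw [h0]
  have h1 : Continuous fun t => c * g t ^ 2 := by fun_prop
  have h2 : Continuous fun t => g t * (f t * g t) := by fun_prop
  refine intervalIntegral.integral_mono_on Real.two_pi_pos.le
    (h1.intervalIntegrable (μ := volume) _ _) (h2.intervalIntegrable (μ := volume) _ _) fun t _ => ?_
  nlinarith [mul_le_mul_of_nonneg_right (hc t) (sq_nonneg (g t))]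

theorem integral_sq_mul_le {f g : ℝ → ℝ} (hf : Continuous f) (hg : Continuous g)
    (hg2 : ∫ t in (0 : ℝ)..(2 * π), g t ^ 2 = π) {c : ℝ} (hc : ∀ t, f t ≤ c) :
    ∫ t in (0 : ℝ)..(2 * π), g t * (f t * g t) ≤ c * π := by
  have := le_integral_sq_mul hf.neg hg hg2 (c := -c) fun t => by
    simp only [Pi.neg_apply]; linarith [hc t]
  simp only [Pi.neg_apply, neg_mul, mul_neg, intervalIntegral.integral_neg] at this
  linarith

theorem ofReal_mem_hillSpace {a W V : ℝ → ℝ} {l : ℝ} (hp : Function.Periodic W (2 * π))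
    (hW : ∀ t, HasDerivAt W (V t) t) (hV : ∀ t, HasDerivAt V ((a t - l) * W t) t) :
    (fun t => (W t : ℂ)) ∈ hillSpace a l :=
  ⟨fun t => by simp only [hp t], fun t => (V t : ℂ), fun t => (hW t).ofReal_comp, fun t => by
    simpa using (hV t).ofReal_comp⟩

/-! ### From a singular matrix to a pair of eigenvalues -/

/-- The restriction to the period of a continuous function. -/
def onPeriod (f : ℝ → ℝ) (hf : Continuous f) : C(Icc (0 : ℝ) (2 * π), ℝ) :=
  ⟨fun x => f x, hf.comp continuous_subtype_val⟩

theorem onPeriod_apply {f : ℝ → ℝ} (hf : Continuous f) (x : Icc (0 : ℝ) (2 * π)) :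
    onPeriod f hf x = f x := rfl

theorem norm_onPeriod_le {f : ℝ → ℝ} (hf : Continuous f) {B : ℝ} (hB : ∀ x, |f x| ≤ B) :
    ‖onPeriod f hf‖ ≤ B :=
  (ContinuousMap.norm_le _ ((abs_nonneg _).trans (hB 0))).2 fun x => hB x

noncomputable def cosOnPeriod (n : ℕ) : C(Icc (0 : ℝ) (2 * π), ℝ) :=
  onPeriod (fun t => Real.cos (n * t)) (by fun_prop)

noncomputable def sinOnPeriod (n : ℕ) : C(Icc (0 : ℝ) (2 * π), ℝ) :=
  onPeriod (fun t => Real.sin (n * t)) (by fun_prop)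

theorem eq_zero_of_smul_cos_add_smul_sin {n : ℕ} (hn : 0 < n) {x y : ℝ}
    (h : x • cosOnPeriod n + y • sinOnPeriod n = 0) : x = 0 ∧ y = 0 := by
  have hpi := Real.pi_pos
  have hn1 : (1 : ℝ) ≤ n := by exact_mod_cast hn
  have h1 := congrArg (fun f => f ⟨0, le_rfl, Real.two_pi_pos.le⟩) h
  have h2 := congrArg (fun f => f ⟨π / (2 * n), by positivity, by
    rw [div_le_iff₀ (by positivity)]; nlinarith⟩) h
  have e : (n : ℝ) * (π / (2 * n)) = π / 2 := by field_simp
  simp only [cosOnPeriod, sinOnPeriod, ContinuousMap.add_apply, ContinuousMap.smul_apply,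
    onPeriod_apply, e, ContinuousMap.zero_apply] at h1 h2
  simpa using And.intro h1 h2

theorem hillResolvent_eq_zero {n : ℕ} (hn : 0 < n) {b v : C(Icc (0 : ℝ) (2 * π), ℝ)}
    (hb : 6 * π / n * ‖b‖ ≤ 1 / 2) (h : hillResolvent hn b v = 0) : v = 0 := by
  have := hillResolvent_eq hn hb v
  rw [h] at this
  simpa using this.symm

/-- The Lyapunov–Schmidt step: `hc` and `hs` say that `(x, y)` is in the kernel of the reduced
matrix, and by linearity of the resolvent they become the two orthogonality conditions for the
solution `w`. -/
theorem exists_mem_hillSpace {a : ℝ → ℝ} (ha : Continuous a) (hap : Function.Periodic a (2 * π))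
    {n : ℕ} (hn : 0 < n) {μ : ℝ} {b : C(Icc (0 : ℝ) (2 * π), ℝ)} (hbμ : ∀ t, b t = a t - μ)
    (hb : 6 * π / n * ‖b‖ ≤ 1 / 2) {x y : ℝ}
    (hc : x * periodIntegral (cosOnPeriod n * (b * hillResolvent hn b (cosOnPeriod n))) +
      y * periodIntegral (cosOnPeriod n * (b * hillResolvent hn b (sinOnPeriod n))) = 0)
    (hs : x * periodIntegral (sinOnPeriod n * (b * hillResolvent hn b (cosOnPeriod n))) +
      y * periodIntegral (sinOnPeriod n * (b * hillResolvent hn b (sinOnPeriod n))) = 0) :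
    ∃ W : ℝ → ℝ, (fun t => (W t : ℂ)) ∈ hillSpace a ((n : ℝ) ^ 2 + μ : ℝ) ∧
      ∀ t : Icc (0 : ℝ) (2 * π), W t = hillResolvent hn b (x • cosOnPeriod n + y • sinOnPeriod n) t := by
  have hlin : ∀ v : C(Icc (0 : ℝ) (2 * π), ℝ),
      periodIntegral (v * (b * hillResolvent hn b (x • cosOnPeriod n + y • sinOnPeriod n))) =
      x * periodIntegral (v * (b * hillResolvent hn b (cosOnPeriod n))) +
      y * periodIntegral (v * (b * hillResolvent hn b (sinOnPeriod n))) := fun v => by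
    simp only [map_add, map_smul, mul_add, mul_smul_comm, smul_eq_mul]
  rw [← hlin] at hc hs
  have heq := hillResolvent_eq hn hb (x • cosOnPeriod n + y • sinOnPeriod n)
  set w := hillResolvent hn b (x • cosOnPeriod n + y • sinOnPeriod n)
  obtain ⟨W, V, hWp, hW, hV, hWw⟩ := exists_periodic_solution ha hap (n := n) hn.ne' (μ := μ)
    (x := x) (y := y) (continuous_periodExtend w) (fun t ht => by
      have h1 := congrArg (fun f => f ⟨t, ht⟩) heq
      simp only [ContinuousMap.add_apply, ContinuousMap.smul_apply, greenOp_apply] at h1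
      rw [show periodExtend w t = w ⟨t, ht⟩ from periodExtend_coe w ⟨t, ht⟩, h1]
      congr 1
      refine green_congr ht fun s hs => ?_
      rw [show periodExtend w s = w ⟨s, hs⟩ from periodExtend_coe w ⟨s, hs⟩,
        show periodExtend (b * w) s = (b * w) ⟨s, hs⟩ from periodExtend_coe _ ⟨s, hs⟩,
        ContinuousMap.mul_apply, hbμ])
    (by
      rw [← hc, cosPrim]
      refine (periodIntegral_eq fun t => ?_).symm
      simp only [ContinuousMap.mul_apply, periodExtend_coe, hbμ]
      rfl)
    (by
      rw [← hs, sinPrim]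
      refine (periodIntegral_eq fun t => ?_).symm
      simp only [ContinuousMap.mul_apply, periodExtend_coe, hbμ]
      rfl)
  exact ⟨W, ofReal_mem_hillSpace hWp hW hV, fun t => (hWw t t.2).trans (periodExtend_coe w t)⟩

theorem hillSpace_ne_bot_of_singular {a : ℝ → ℝ} (ha : Continuous a)
    (hap : Function.Periodic a (2 * π))
    {n : ℕ} (hn : 0 < n) {μ : ℝ} {b : C(Icc (0 : ℝ) (2 * π), ℝ)} (hbμ : ∀ t, b t = a t - μ)
    (hb : 6 * π / n * ‖b‖ ≤ 1 / 2)
    (h : periodIntegral (cosOnPeriod n * (b * hillResolvent hn b (cosOnPeriod n))) *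
      periodIntegral (sinOnPeriod n * (b * hillResolvent hn b (sinOnPeriod n))) =
      periodIntegral (cosOnPeriod n * (b * hillResolvent hn b (sinOnPeriod n))) ^ 2) :
    hillSpace a ((n : ℝ) ^ 2 + μ : ℝ) ≠ ⊥ := by
  have hsymm := periodIntegral_hillResolvent_symm hn hb (sinOnPeriod n) (cosOnPeriod n)
  set p := periodIntegral (cosOnPeriod n * (b * hillResolvent hn b (cosOnPeriod n)))
  set q := periodIntegral (cosOnPeriod n * (b * hillResolvent hn b (sinOnPeriod n))) with hq
  set r := periodIntegral (sinOnPeriod n * (b * hillResolvent hn b (sinOnPeriod n)))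
  obtain ⟨x, y, hxy, h1, h2⟩ : ∃ x y : ℝ, ¬(x = 0 ∧ y = 0) ∧ x * p + y * q = 0 ∧
      x * q + y * r = 0 := by
    -- A kernel vector of a singular symmetric matrix: `(q, -p)`, unless the first row vanishes.
    by_cases hp : p = 0 ∧ q = 0
    · exact ⟨1, 0, by simp, by simp [hp.1], by simp [hp.2]⟩
    · exact ⟨q, -p, by simpa [and_comm] using hp, by ring, by linarith⟩
  obtain ⟨W, hW, hWw⟩ := exists_mem_hillSpace ha hap hn hbμ hb h1 (by rw [hsymm]; exact h2)
  intro hbot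
  rw [hbot, Submodule.mem_bot] at hW
  refine hxy (eq_zero_of_smul_cos_add_smul_sin hn (hillResolvent_eq_zero hn hb ?_))
  ext t
  rw [← hWw t]
  exact Complex.ofReal_eq_zero.1 (congrFun hW t)

theorem two_le_finrank_hillSpace {a : ℝ → ℝ} (ha : Continuous a)
    (hap : Function.Periodic a (2 * π))
    {n : ℕ} (hn : 0 < n) {μ : ℝ} {b : C(Icc (0 : ℝ) (2 * π), ℝ)} (hbμ : ∀ t, b t = a t - μ)
    (hb : 6 * π / n * ‖b‖ ≤ 1 / 2)
    (hp : periodIntegral (cosOnPeriod n * (b * hillResolvent hn b (cosOnPeriod n))) = 0)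
    (hq : periodIntegral (cosOnPeriod n * (b * hillResolvent hn b (sinOnPeriod n))) = 0)
    (hr : periodIntegral (sinOnPeriod n * (b * hillResolvent hn b (sinOnPeriod n))) = 0)
    (hfin : FiniteDimensional ℂ (hillSpace a ((n : ℝ) ^ 2 + μ : ℝ))) :
    2 ≤ Module.finrank ℂ (hillSpace a ((n : ℝ) ^ 2 + μ : ℝ)) := by
  have hq' := periodIntegral_hillResolvent_symm hn hb (sinOnPeriod n) (cosOnPeriod n)
  rw [hq] at hq'
  obtain ⟨W₁, hW₁, hw₁⟩ := exists_mem_hillSpace ha hap hn hbμ hb (x := 1) (y := 0)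
    (by rw [hp, hq]; ring) (by rw [hq', hr]; ring)
  obtain ⟨W₂, hW₂, hw₂⟩ := exists_mem_hillSpace ha hap hn hbμ hb (x := 0) (y := 1)
    (by rw [hp, hq]; ring) (by rw [hq', hr]; ring)
  have hreal : ∀ x y : ℝ, (∀ t, x * W₁ t + y * W₂ t = 0) → x = 0 ∧ y = 0 := fun x y h => by
    refine eq_zero_of_smul_cos_add_smul_sin hn (hillResolvent_eq_zero hn hb ?_)
    ext t
    have := h t
    rw [hw₁ t, hw₂ t] at this
    simpa using this
  -- The two solutions are real-valued, so a complex relation splits into two real ones.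
  have hli : LinearIndependent ℂ ![(⟨_, hW₁⟩ : hillSpace a ((n : ℝ) ^ 2 + μ : ℝ)), ⟨_, hW₂⟩] := by
    rw [LinearIndependent.pair_iff]
    intro s t hst
    have h0 : ∀ x, s * W₁ x + t * W₂ x = 0 := fun x => congrFun (congrArg Subtype.val hst) x
    have hre := hreal s.re t.re fun x => by simpa using congrArg Complex.re (h0 x)
    have him := hreal s.im t.im fun x => by simpa using congrArg Complex.im (h0 x)
    exact ⟨Complex.ext hre.1 him.1, Complex.ext hre.2 him.2⟩
  simpa using hli.fintype_card_le_finrank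

/-- Two eigenvalues of Hill's operator, counted with multiplicity, close to each large square. -/
theorem exists_eigenvalue_pair {a : ℝ → ℝ} (ha : Continuous a) (hap : Function.Periodic a (2 * π))
    {α : ℝ} (hα : ∀ x, |a x| ≤ α) : ∃ n₀ : ℕ, ∀ n : ℕ, n₀ ≤ n → ∃ l₁ l₂ : ℝ,
      |l₁ - (n : ℝ) ^ 2| ≤ 2 * α + 1 ∧ |l₂ - (n : ℝ) ^ 2| ≤ 2 * α + 1 ∧
      hillSpace a l₁ ≠ ⊥ ∧ hillSpace a l₂ ≠ ⊥ ∧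
      (l₁ = l₂ → FiniteDimensional ℂ (hillSpace a l₁) → 2 ≤ Module.finrank ℂ (hillSpace a l₁)) := by
  have hα0 : 0 ≤ α := (abs_nonneg _).trans (hα 0)
  have hpi := Real.pi_gt_three
  -- A bound for `|a - μ|` when `|μ| ≤ 2 α + 1`.
  set K := 3 * α + 1 with hK
  -- The term `12πK` makes the Neumann condition `6πK/n ≤ 1/2` hold; the term `24π²K²` makes each
  -- matrix entry differ by at most `1` from its value with the resolvent replaced by the identity.
  obtain ⟨n₀, hn₀⟩ := exists_nat_ge (12 * π * K + 24 * π ^ 2 * K ^ 2 + 1)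
  refine ⟨n₀, fun n hn => ?_⟩
  have hnR : 12 * π * K + 24 * π ^ 2 * K ^ 2 + 1 ≤ n := hn₀.trans (by exact_mod_cast hn)
  have hn1 : (0 : ℝ) < n := lt_of_lt_of_le (by positivity) hnR
  have hn0 : 0 < n := by exact_mod_cast hn1
  set C := 2 * α + 1 with hC
  have hbc : ∀ μ, Continuous fun t => a t - μ := fun μ => by fun_prop
  set b : ℝ → C(Icc (0 : ℝ) (2 * π), ℝ) := fun μ => onPeriod (fun t => a t - μ) (hbc μ) with hb
  have hbK : ∀ μ ∈ Icc (-C) C, ‖b μ‖ ≤ K := fun μ hμ => norm_onPeriod_le _ fun x => by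
    have := abs_le.1 (hα x)
    rw [abs_le]
    constructor <;> linarith [hμ.1, hμ.2]
  have hsmall : ∀ μ ∈ Icc (-C) C, 6 * π / n * ‖b μ‖ ≤ 1 / 2 := fun μ hμ => by
    have h1 : 6 * π / n * ‖b μ‖ ≤ 6 * π / n * K := by gcongr; exact hbK μ hμ
    have h2 : 6 * π / n * K ≤ 1 / 2 := by
      rw [div_mul_eq_mul_div, div_le_iff₀ hn1]
      nlinarith [mul_nonneg (sq_nonneg π) (sq_nonneg K)]
    exact h1.trans h2
  have hcos1 : ‖cosOnPeriod n‖ ≤ 1 := norm_onPeriod_le _ fun x => Real.abs_cos_le_one _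
  have hsin1 : ‖sinOnPeriod n‖ ≤ 1 := norm_onPeriod_le _ fun x => Real.abs_sin_le_one _
  have happrox : ∀ μ ∈ Icc (-C) C, ∀ v w : C(Icc (0 : ℝ) (2 * π), ℝ), ‖v‖ ≤ 1 → ‖w‖ ≤ 1 →
      |periodIntegral (v * (b μ * hillResolvent hn0 (b μ) w)) -
        periodIntegral (v * (b μ * w))| ≤ 1 := fun μ hμ v w hv hw => by
    rw [← map_sub, ← mul_sub, ← mul_sub]
    have h1 := norm_hillResolvent_sub_le hn0 (hsmall μ hμ) hw
    have h2 : ‖v * (b μ * (hillResolvent hn0 (b μ) w - w))‖ ≤ 1 * (K * (2 * (6 * π / n * K))) := by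
      refine (norm_mul_le _ _).trans (mul_le_mul hv ((norm_mul_le _ _).trans (mul_le_mul (hbK μ hμ)
        (h1.trans ?_) (norm_nonneg _) (by positivity))) (norm_nonneg _) zero_le_one)
      gcongr
      exact hbK μ hμ
    refine (abs_periodIntegral_le _).trans ((mul_le_mul_of_nonneg_left h2 (by positivity)).trans ?_)
    have : 2 * π * (1 * (K * (2 * (6 * π / n * K)))) = 24 * π ^ 2 * K ^ 2 / n := by ring
    rw [this, div_le_one hn1]
    have : 0 ≤ 12 * π * K := by positivity
    linarith
  have hcont : ∀ v w : C(Icc (0 : ℝ) (2 * π), ℝ), ContinuousOn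
      (fun μ => periodIntegral (v * (b μ * hillResolvent hn0 (b μ) w))) (Icc (-C) C) := by
    intro v w μ hμ
    have hbcont : Continuous b := by
      have : b = fun μ => onPeriod a ha - μ • (1 : C(Icc (0 : ℝ) (2 * π), ℝ)) := by
        funext μ; ext t; simp [hb, onPeriod_apply]
      rw [this]; fun_prop
    have hR : ContinuousAt (fun μ => hillResolvent hn0 (b μ)) μ :=
      ContinuousAt.comp (f := b) (hillResolvent_continuousAt hn0 (hsmall μ hμ)) hbcont.continuousAt
    have hRw : ContinuousAt (fun μ => hillResolvent hn0 (b μ) w) μ := hR.clm_apply continuousAt_const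
    exact (periodIntegral.continuous.continuousAt.comp (continuousAt_const.mul
      (hbcont.continuousAt.mul hRw))).continuousWithinAt
  have hqb : ∀ μ, |periodIntegral (cosOnPeriod n * (b μ * sinOnPeriod n))| ≤ π * α := fun μ => by
    rw [periodIntegral_eq (g := fun t => Real.cos (n * t) * ((a t - μ) * Real.sin (n * t)))
      fun x => rfl]
    exact abs_integral_cos_mul_sin_le ha hα hn0.ne' μ
  have hCmem : C ∈ Icc (-C) C := ⟨by linarith, le_rfl⟩
  have hCmem' : -C ∈ Icc (-C) C := ⟨le_rfl, by linarith⟩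
  have hlow : ∀ g : ℝ → ℝ, ∀ hg : Continuous g, ∫ t in (0 : ℝ)..(2 * π), g t ^ 2 = π →
      (α + 1) * π ≤ periodIntegral (onPeriod g hg * (b (-C) * onPeriod g hg)) := fun g hg h => by
    rw [periodIntegral_eq (g := fun t => g t * ((a t - -C) * g t)) fun x => rfl]
    exact le_integral_sq_mul (hbc _) hg h fun t => by linarith [(abs_le.1 (hα t)).1]
  have hupp : ∀ g : ℝ → ℝ, ∀ hg : Continuous g, ∫ t in (0 : ℝ)..(2 * π), g t ^ 2 = π →
      periodIntegral (onPeriod g hg * (b C * onPeriod g hg)) ≤ -(α + 1) * π := fun g hg h => by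
    rw [periodIntegral_eq (g := fun t => g t * ((a t - C) * g t)) fun x => rfl]
    exact integral_sq_mul_le (hbc _) hg h fun t => by linarith [(abs_le.1 (hα t)).2]
  have hc2 := integral_cos_sq_mul hn0.ne'
  have hs2 := integral_sin_sq_mul hn0.ne'
  -- At `μ = ∓C` the diagonal entries are at least `(α + 1)π - 1` in modulus, positive at `-C` and
  -- negative at `C`. The off-diagonal entry is at most `απ + 1`. Diagonal dominance therefore only
  -- needs `π > 2`.
  obtain ⟨x, hx, y, hy, h1, h2, h3⟩ := exists_two_singular (s := -C) (t := C) (by linarith)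
    (hcont (cosOnPeriod n) (cosOnPeriod n)) (hcont (cosOnPeriod n) (sinOnPeriod n))
    (hcont (sinOnPeriod n) (sinOnPeriod n))
    (by
      have e1 := abs_le.1 (happrox _ hCmem' _ _ hcos1 hcos1)
      have e2 := abs_le.1 (happrox _ hCmem' _ _ hcos1 hsin1)
      have e3 := hlow _ (by fun_prop) hc2
      have e4 := abs_le.1 (hqb (-C))
      change (α + 1) * π ≤ periodIntegral (cosOnPeriod n * (b (-C) * cosOnPeriod n)) at e3
      rw [abs_lt]; constructor <;> linarith)
    (by
      have e1 := abs_le.1 (happrox _ hCmem' _ _ hsin1 hsin1)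
      have e2 := abs_le.1 (happrox _ hCmem' _ _ hcos1 hsin1)
      have e3 := hlow _ (by fun_prop) hs2
      have e4 := abs_le.1 (hqb (-C))
      change (α + 1) * π ≤ periodIntegral (sinOnPeriod n * (b (-C) * sinOnPeriod n)) at e3
      rw [abs_lt]; constructor <;> linarith)
    (by
      have e1 := abs_le.1 (happrox _ hCmem _ _ hcos1 hcos1)
      have e2 := abs_le.1 (happrox _ hCmem _ _ hcos1 hsin1)
      have e3 := hupp _ (by fun_prop) hc2
      have e4 := abs_le.1 (hqb C)
      change periodIntegral (cosOnPeriod n * (b C * cosOnPeriod n)) ≤ _ at e3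
      rw [abs_lt]; constructor <;> linarith)
    (by
      have e1 := abs_le.1 (happrox _ hCmem _ _ hsin1 hsin1)
      have e2 := abs_le.1 (happrox _ hCmem _ _ hcos1 hsin1)
      have e3 := hupp _ (by fun_prop) hs2
      have e4 := abs_le.1 (hqb C)
      change periodIntegral (sinOnPeriod n * (b C * sinOnPeriod n)) ≤ _ at e3
      rw [abs_lt]; constructor <;> linarith)
  refine ⟨(n : ℝ) ^ 2 + x, (n : ℝ) ^ 2 + y, by rw [add_sub_cancel_left]; exact abs_le.2 hx,
    by rw [add_sub_cancel_left]; exact abs_le.2 hy,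
    hillSpace_ne_bot_of_singular ha hap hn0 (fun _ => rfl) (hsmall x hx) h1,
    hillSpace_ne_bot_of_singular ha hap hn0 (fun _ => rfl) (hsmall y hy) h2, fun hxy hfin => ?_⟩
  obtain ⟨e1, e2, e3⟩ := h3 (by linarith)
  exact two_le_finrank_hillSpace ha hap hn0 (fun _ => rfl) (hsmall x hx) e1 e2 e3 hfin

/-! ### Asymptotics of eigenfunctions and eigenvalues -/

/-- Serves twice: for general `x`, together with its sine analogue, it yields variation of
constants; at `x = 2π` with `ω = n` and `u` periodic, it yields orthogonality of the forcing to `cos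
nt`. -/
theorem cosPrim_forcing {ω : ℝ} {u v f : ℝ → ℝ} (hf : Continuous f) (hu : ∀ x, HasDerivAt u (v x) x)
    (hv : ∀ x, HasDerivAt v (f x - ω ^ 2 * u x) x) (x : ℝ) :
    cosPrim ω f x = Real.cos (ω * x) * v x + ω * Real.sin (ω * x) * u x - v 0 := by
  have h : ∀ t ∈ uIcc 0 x, HasDerivAt
      (fun t => Real.cos (ω * t) * v t + ω * Real.sin (ω * t) * u t) (Real.cos (ω * t) * f t) t :=
    fun t _ => by
      refine (((hasDerivAt_cos_mul ω t).mul (hv t)).add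
        (((hasDerivAt_sin_mul ω t).const_mul ω).mul (hu t))).congr_deriv ?_
      ring
  rw [cosPrim, intervalIntegral.integral_eq_sub_of_hasDerivAt h
    (Continuous.intervalIntegrable (by fun_prop) _ _)]
  simp

theorem sinPrim_forcing {ω : ℝ} {u v f : ℝ → ℝ} (hf : Continuous f) (hu : ∀ x, HasDerivAt u (v x) x)
    (hv : ∀ x, HasDerivAt v (f x - ω ^ 2 * u x) x) (x : ℝ) :
    sinPrim ω f x = Real.sin (ω * x) * v x - ω * Real.cos (ω * x) * u x + ω * u 0 := by
  have h : ∀ t ∈ uIcc 0 x, HasDerivAt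
      (fun t => Real.sin (ω * t) * v t - ω * Real.cos (ω * t) * u t) (Real.sin (ω * t) * f t) t :=
    fun t _ => by
      refine (((hasDerivAt_sin_mul ω t).mul (hv t)).sub
        (((hasDerivAt_cos_mul ω t).const_mul ω).mul (hu t))).congr_deriv ?_
      ring
  rw [sinPrim, intervalIntegral.integral_eq_sub_of_hasDerivAt h
    (Continuous.intervalIntegrable (by fun_prop) _ _)]
  simp

theorem variation_of_constants {ω : ℝ} (hω : ω ≠ 0) {u v f : ℝ → ℝ} (hf : Continuous f)
    (hu : ∀ x, HasDerivAt u (v x) x) (hv : ∀ x, HasDerivAt v (f x - ω ^ 2 * u x) x) (x : ℝ) :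
    u x = u 0 * Real.cos (ω * x) + v 0 / ω * Real.sin (ω * x) + duhamel ω f x := by
  rw [duhamel, cosPrim_forcing hf hu hv, sinPrim_forcing hf hu hv]
  field_simp
  linear_combination (-ω * u x) * Real.sin_sq_add_cos_sq (ω * x)

theorem exists_amplitude_phase {n : ℕ} (hn : 0 < n) (p q : ℝ) :
    ∃ ρ θ : ℝ, 0 ≤ ρ ∧ θ ∈ Icc 0 (2 * π) ∧
      ∀ x : ℝ, p * Real.cos (n * x) + q * Real.sin (n * x) = ρ * Real.cos (n * (x - θ)) := by
  have hn1 : (1 : ℝ) ≤ n := by exact_mod_cast hn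
  obtain ⟨ρ, ψ, hρ, hψ, hp, hq⟩ : ∃ ρ ψ : ℝ, 0 ≤ ρ ∧ ψ ∈ Icc 0 (2 * π) ∧ p = ρ * Real.cos ψ ∧
      q = ρ * Real.sin ψ := by
    set z : ℂ := ⟨p, q⟩
    have h1 : ‖z‖ * Real.cos z.arg = p := Complex.norm_mul_cos_arg z
    have h2 : ‖z‖ * Real.sin z.arg = q := Complex.norm_mul_sin_arg z
    by_cases h : 0 ≤ z.arg
    · exact ⟨‖z‖, z.arg, norm_nonneg _, ⟨h, by linarith [Complex.arg_le_pi z, Real.pi_pos]⟩,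
        h1.symm, h2.symm⟩
    · refine ⟨‖z‖, z.arg + 2 * π, norm_nonneg _, ⟨?_, by linarith⟩, ?_, ?_⟩
      · linarith [Complex.neg_pi_lt_arg z, Real.pi_pos]
      · rw [Real.cos_add_two_pi, h1]
      · rw [Real.sin_add_two_pi, h2]
  refine ⟨ρ, ψ / n, hρ, ⟨div_nonneg hψ.1 (by positivity), ?_⟩, fun x => ?_⟩
  · exact (div_le_self hψ.1 hn1).trans hψ.2
  · rw [mul_sub, mul_div_cancel₀ _ (by positivity), Real.cos_sub, hp, hq]
    ring

theorem integral_cos_sq_shift {n : ℕ} (hn : n ≠ 0) (θ : ℝ) :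
    ∫ t in (0 : ℝ)..(2 * π), Real.cos (n * (t - θ)) ^ 2 = π := by
  have h : ∀ t : ℝ, Real.cos (n * (t - θ)) ^ 2 = Real.cos (n * θ) ^ 2 * Real.cos (n * t) ^ 2
      + (Real.sin (n * θ) ^ 2 * Real.sin (n * t) ^ 2
      + 2 * Real.cos (n * θ) * Real.sin (n * θ) * (Real.cos (n * t) * Real.sin (n * t))) :=
    fun t => by rw [mul_sub, Real.cos_sub]; ring
  simp only [h]
  rw [intervalIntegral.integral_add (Continuous.intervalIntegrable (by fun_prop) _ _)
    (Continuous.intervalIntegrable (by fun_prop) _ _),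
    intervalIntegral.integral_add (Continuous.intervalIntegrable (by fun_prop) _ _)
    (Continuous.intervalIntegrable (by fun_prop) _ _)]
  simp only [intervalIntegral.integral_const_mul]
  rw [integral_cos_sq_mul hn, integral_sin_sq_mul hn, integral_cos_mul_sin hn]
  linear_combination π * Real.sin_sq_add_cos_sq (n * θ)

/-- Integration by parts; the boundary terms cancel by periodicity. This decay is the only use of
the derivative of `a`, and it supplies the `O(1/n)` for the oscillating part of the eigenvalue
formula. -/
theorem abs_integral_mul_cos_le {a : ℝ → ℝ} (hap : Function.Periodic a (2 * π))
    (hac : AbsolutelyContinuousOnInterval a 0 (2 * π)) {m : ℕ} (hm : 0 < m) (θ : ℝ) :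
    |∫ t in (0 : ℝ)..(2 * π), a t * Real.cos (m * (t - θ))| ≤
      (∫ t in (0 : ℝ)..(2 * π), |deriv a t|) / m := by
  have hm' : (m : ℝ) ≠ 0 := by positivity
  set g : ℝ → ℝ := fun t => Real.sin (m * (t - θ)) / m with hg
  have hd : ∀ t, HasDerivAt g (Real.cos (m * (t - θ))) t := fun t => by
    refine ((((hasDerivAt_id t).sub_const θ).const_mul (m : ℝ)).sin.div_const _).congr_deriv ?_
    simp only [id]; field_simp
  have hgc : AbsolutelyContinuousOnInterval g 0 (2 * π) :=
    ContDiffOn.absolutelyContinuousOnInterval (ContDiff.contDiffOn (by fun_prop))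
  have h := hac.integral_mul_deriv_eq_deriv_mul hgc
  have hper : g (2 * π) = g 0 := by
    simp only [hg]
    rw [show (m : ℝ) * (2 * π - θ) = m * (0 - θ) + m * (2 * π) by ring,
      Real.sin_add_nat_mul_two_pi]
  have hp0 := hap 0
  rw [zero_add] at hp0
  rw [funext fun t => (hd t).deriv, hper, hp0, sub_self, zero_sub] at h
  rw [h, abs_neg]
  calc |∫ t in (0 : ℝ)..(2 * π), deriv a t * g t|
      ≤ ∫ t in (0 : ℝ)..(2 * π), |deriv a t * g t| :=
        intervalIntegral.abs_integral_le_integral_abs Real.two_pi_pos.le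
    _ ≤ ∫ t in (0 : ℝ)..(2 * π), |deriv a t| * (1 / m) := by
        have hi := hac.intervalIntegrable_deriv
        refine intervalIntegral.integral_mono_on Real.two_pi_pos.le
          (hi.mul_continuousOn hgc.continuousOn).abs (hi.abs.mul_const _) fun t _ => ?_
        rw [abs_mul]
        refine mul_le_mul_of_nonneg_left ?_ (abs_nonneg _)
        rw [hg, abs_div, Nat.abs_cast]
        gcongr
        exact Real.abs_sin_le_one _
    _ = _ := by rw [intervalIntegral.integral_mul_const, mul_one_div]

theorem abs_integral_le_of_abs_le {f g : ℝ → ℝ} (hf : Continuous f) (hg : Continuous g) {x : ℝ}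
    (hx : x ∈ Icc 0 (2 * π)) (h : ∀ t, |f t| ≤ g t) :
    |∫ t in (0 : ℝ)..x, f t| ≤ ∫ t in (0 : ℝ)..(2 * π), g t := by
  have h1 : |∫ t in (0 : ℝ)..x, f t| ≤ ∫ t in (0 : ℝ)..x, |f t| :=
    intervalIntegral.abs_integral_le_integral_abs hx.1
  have h2 : ∫ t in (0 : ℝ)..x, |f t| ≤ ∫ t in (0 : ℝ)..x, g t :=
    intervalIntegral.integral_mono_on hx.1 (hf.abs.intervalIntegrable _ _)
      (hg.intervalIntegrable _ _) fun t _ => h t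
  have h3 : ∫ t in (0 : ℝ)..x, g t ≤ ∫ t in (0 : ℝ)..(2 * π), g t :=
    intervalIntegral.integral_mono_interval le_rfl hx.1 hx.2
      (Eventually.of_forall fun t => (abs_nonneg _).trans (h t)) (hg.intervalIntegrable _ _)
  linarith

/-- Normalised eigenfunctions near a large square are close to a single frequency. -/
theorem eigenfunction_asymptotics {b u v : ℝ → ℝ} (hb : Continuous b) {M : ℝ}
    (hM : ∀ x, |b x| ≤ M) {n : ℕ} (hn : 0 < n) (hnM : M * (2 * π + 1) ≤ n)
    (hup : Function.Periodic u (2 * π)) (hu : ∀ x, HasDerivAt u (v x) x)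
    (hv : ∀ x, HasDerivAt v (b x * u x - (n : ℝ) ^ 2 * u x) x)
    (hnorm : ∫ t in (0 : ℝ)..(2 * π), u t ^ 2 = 1) :
    ∃ θ ∈ Icc 0 (2 * π), ∀ t,
      |u t - 1 / √π * Real.cos (n * (t - θ))| ≤ 29 * (M * (2 * π + 1)) / n := by
  have hn' : (0 : ℝ) < n := by positivity
  have hpi := Real.pi_gt_three
  have hM0 : 0 ≤ M := (abs_nonneg _).trans (hM 0)
  have huc : Continuous u := continuous_iff_continuousAt.2 fun x => (hu x).continuousAt
  have hfc : Continuous fun t => b t * u t := by fun_prop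
  -- No sup bound on `u` is available yet; `|u| ≤ (1 + u²)/2` and the normalisation bound the
  -- forcing in `L¹`, which suffices for the Duhamel term.
  have hL1 : ∫ t in (0 : ℝ)..(2 * π), M * ((1 + u t ^ 2) / 2) = M * (2 * π + 1) / 2 := by
    rw [intervalIntegral.integral_const_mul, intervalIntegral.integral_div,
      intervalIntegral.integral_add (by simp) (Continuous.intervalIntegrable (by fun_prop) _ _),
      hnorm]
    simp; ring
  have hfb : ∀ t, |b t * u t| ≤ M * ((1 + u t ^ 2) / 2) := fun t => by
    rw [abs_mul]
    have : |u t| ≤ (1 + u t ^ 2) / 2 := by nlinarith [sq_nonneg (|u t| - 1), sq_abs (u t)]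
    exact mul_le_mul (hM t) this (abs_nonneg _) hM0
  set ε := M * (2 * π + 1) / n with hε
  have hε0 : 0 ≤ ε := by positivity
  have hε1 : ε ≤ 1 := by rw [hε, div_le_one hn']; exact hnM
  have hduh : ∀ x ∈ Icc 0 (2 * π), |duhamel n (fun t => b t * u t) x| ≤ ε := fun x hx => by
    rw [duhamel, abs_div, abs_of_pos hn', hε]
    gcongr
    have h1 : |cosPrim n (fun t => b t * u t) x| ≤ M * (2 * π + 1) / 2 := by
      rw [← hL1]
      refine abs_integral_le_of_abs_le (by fun_prop) (by fun_prop) hx fun t => ?_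
      rw [abs_mul]
      nlinarith [hfb t, Real.abs_cos_le_one (n * t), abs_nonneg (b t * u t)]
    have h2 : |sinPrim n (fun t => b t * u t) x| ≤ M * (2 * π + 1) / 2 := by
      rw [← hL1]
      refine abs_integral_le_of_abs_le (by fun_prop) (by fun_prop) hx fun t => ?_
      rw [abs_mul]
      nlinarith [hfb t, Real.abs_sin_le_one (n * t), abs_nonneg (b t * u t)]
    have := abs_mul_sub_mul_le (Real.abs_sin_le_one (n * x)) (Real.abs_cos_le_one (n * x)) h1 h2
    linarith
  obtain ⟨ρ, θ, hρ, hθ, hamp⟩ := exists_amplitude_phase hn (u 0) (v 0 / n)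
  have hclose : ∀ t, |u t - ρ * Real.cos (n * (t - θ))| ≤ ε := by
    have hper : Function.Periodic (fun t => u t - ρ * Real.cos (n * (t - θ))) (2 * π) := fun t => by
      simp only [hup t]
      rw [show (n : ℝ) * (t + 2 * π - θ) = n * (t - θ) + n * (2 * π) by ring,
        Real.cos_add_nat_mul_two_pi]
    intro t
    obtain ⟨y, hy, hty⟩ := hper.exists_mem_Ico₀ Real.two_pi_pos t
    rw [hty, variation_of_constants hn'.ne' hfc hu hv y, hamp, add_sub_cancel_left]
    exact hduh y (Ico_subset_Icc_self hy)
  have hcc : Continuous fun t : ℝ => Real.cos (n * (t - θ)) := by fun_prop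
  have hc2 := integral_cos_sq_shift hn.ne' θ
  have hρ2 : ∫ t in (0 : ℝ)..(2 * π), (ρ * Real.cos (n * (t - θ))) ^ 2 = ρ ^ 2 * π := by
    simp only [mul_pow]
    rw [intervalIntegral.integral_const_mul, hc2]
  -- Since `u` is within `1` of `ρ cos`, integrating `(ρ cos)² ≤ 2u² + 2` gives `ρ² π ≤ 2 + 4π <
  -- 9π`.
  have hρ3 : ρ ≤ 3 := by
    have h : ∫ t in (0 : ℝ)..(2 * π), (ρ * Real.cos (n * (t - θ))) ^ 2 ≤
        ∫ t in (0 : ℝ)..(2 * π), (2 * u t ^ 2 + 2) := by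
      refine intervalIntegral.integral_mono_on Real.two_pi_pos.le
        (Continuous.intervalIntegrable (by fun_prop) _ _)
        (Continuous.intervalIntegrable (by fun_prop) _ _) fun t _ => ?_
      have h1 := (sq_le_one_iff_abs_le_one _).2 ((hclose t).trans hε1)
      nlinarith [sq_nonneg (2 * u t - ρ * Real.cos (n * (t - θ)))]
    rw [hρ2, intervalIntegral.integral_add (Continuous.intervalIntegrable (by fun_prop) _ _)
      (by simp), intervalIntegral.integral_const_mul, hnorm] at h
    simp only [intervalIntegral.integral_const, sub_zero, smul_eq_mul] at h
    by_contra hlt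
    push Not at hlt
    have h9 : 9 < ρ ^ 2 := by nlinarith
    nlinarith
  -- The factor `7` bounds `|u + ρ cos| ≤ |u - ρ cos| + 2ρ ≤ 1 + 6`, and the period contributes
  -- `2π`.
  have hdiff : |1 - ρ ^ 2 * π| ≤ 14 * π * ε := by
    rw [← hρ2]
    nth_rewrite 1 [← hnorm]
    rw [← intervalIntegral.integral_sub (Continuous.intervalIntegrable (by fun_prop) _ _)
      (Continuous.intervalIntegrable (by fun_prop) _ _)]
    have h := abs_integral_le_of_abs_le (x := 2 * π) (g := fun _ => 7 * ε)
      (f := fun t => u t ^ 2 - (ρ * Real.cos (n * (t - θ))) ^ 2) (by fun_prop) (by fun_prop)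
      ⟨Real.two_pi_pos.le, le_rfl⟩ fun t => by
        have h1 := hclose t
        have h2 : |ρ * Real.cos (n * (t - θ))| ≤ 3 := by
          rw [abs_mul, abs_of_nonneg hρ]
          nlinarith [Real.abs_cos_le_one (n * (t - θ)), abs_nonneg (Real.cos (n * (t - θ)))]
        have h3 : |u t + ρ * Real.cos (n * (t - θ))| ≤ 7 := by
          rw [abs_le] at h1 h2 ⊢
          constructor <;> linarith
        rw [sq_sub_sq, abs_mul]
        exact mul_le_mul h3 h1 (abs_nonneg _) (by norm_num)
    simp only [intervalIntegral.integral_const, sub_zero, smul_eq_mul] at h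
    linarith
  have hs : 0 < √π := Real.sqrt_pos.2 Real.pi_pos
  have hs2 : √π ^ 2 = π := Real.sq_sqrt Real.pi_pos.le
  have hs3 : √π ≤ 2 := by
    rw [Real.sqrt_le_left (by norm_num)]; linarith [Real.pi_le_four]
  -- Factor `1 - ρ²π = (1/√π - ρ)(1/√π + ρ)π` and use `1/√π ≥ 1/2`. The final constant is `29 = 1 +
  -- 28`.
  have hρs : |ρ - 1 / √π| ≤ 28 * ε := by
    have e : 1 - ρ ^ 2 * π = (1 / √π - ρ) * ((1 / √π + ρ) * π) := by
      field_simp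
      linear_combination hs2
    rw [e, abs_mul, abs_of_nonneg (by positivity : 0 ≤ (1 / √π + ρ) * π), abs_sub_comm] at hdiff
    have h1 : 1 / 2 * π ≤ (1 / √π + ρ) * π := by
      have : 1 / 2 ≤ 1 / √π := by gcongr
      gcongr
      linarith
    have h2 : |ρ - 1 / √π| * (1 / 2 * π) ≤ 14 * π * ε :=
      (mul_le_mul_of_nonneg_left h1 (abs_nonneg _)).trans hdiff
    nlinarith
  refine ⟨θ, hθ, fun t => ?_⟩
  have e : u t - 1 / √π * Real.cos (n * (t - θ)) =
      (u t - ρ * Real.cos (n * (t - θ))) + (ρ - 1 / √π) * Real.cos (n * (t - θ)) := by ring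
  have h1 : |(ρ - 1 / √π) * Real.cos (n * (t - θ))| ≤ 28 * ε := by
    rw [abs_mul]
    nlinarith [Real.abs_cos_le_one (n * (t - θ)), abs_nonneg (ρ - 1 / √π)]
  rw [e]
  refine (abs_add_le _ _).trans ((add_le_add (hclose t) h1).trans_eq ?_)
  rw [hε]; ring

/-- Eigenvalues near a large square. -/
theorem eigenvalue_asymptotics {a u v : ℝ → ℝ} (ha : Continuous a)
    (hap : Function.Periodic a (2 * π)) (hac : AbsolutelyContinuousOnInterval a 0 (2 * π)) {d M : ℝ}
    (hM : ∀ x, |a x - d| ≤ M) {n : ℕ} (hn : 0 < n)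
    (hup : Function.Periodic u (2 * π)) (hu : ∀ x, HasDerivAt u (v x) x)
    (hv : ∀ x, HasDerivAt v ((a x - d) * u x - (n : ℝ) ^ 2 * u x) x) {θ δ : ℝ}
    (hclose : ∀ t, |u t - 1 / √π * Real.cos (n * (t - θ))| ≤ δ) :
    |d - mean a| ≤ (∫ t in (0 : ℝ)..(2 * π), |deriv a t|) / n + 4 * M * δ := by
  have hn' : (0 : ℝ) < n := by positivity
  have hpi := Real.pi_gt_three
  have hM0 : 0 ≤ M := (abs_nonneg _).trans (hM 0)
  have hδ0 : 0 ≤ δ := (abs_nonneg _).trans (hclose 0)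
  have huc : Continuous u := continuous_iff_continuousAt.2 fun x => (hu x).continuousAt
  have hfc : Continuous fun t => (a t - d) * u t := by fun_prop
  have hvp : v (2 * π) = v 0 := by
    have h1 := (hu (0 + 2 * π)).comp_add_const 0 (2 * π)
    rw [show (fun y => u (y + 2 * π)) = u from funext hup, zero_add] at h1
    exact h1.unique (hu 0)
  have hup0 : u (2 * π) = u 0 := by simpa using hup 0
  have hcos : ∫ t in (0 : ℝ)..(2 * π), Real.cos (n * t) * ((a t - d) * u t) = 0 := by
    have := cosPrim_forcing hfc hu hv (2 * π)
    rw [Real.cos_nat_mul_two_pi, show Real.sin (n * (2 * π)) = 0 by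
      simpa using Real.sin_add_nat_mul_two_pi 0 n, hvp] at this
    rw [cosPrim] at this
    linarith
  have hsin : ∫ t in (0 : ℝ)..(2 * π), Real.sin (n * t) * ((a t - d) * u t) = 0 := by
    have := sinPrim_forcing hfc hu hv (2 * π)
    rw [Real.cos_nat_mul_two_pi, show Real.sin (n * (2 * π)) = 0 by
      simpa using Real.sin_add_nat_mul_two_pi 0 n, hup0] at this
    rw [sinPrim] at this
    linarith
  -- A periodic solution forces `(a - d) u` to be orthogonal to both `cos nt` and `sin nt`, hence to
  -- every shifted cosine of frequency `n`.
  have hphase : ∫ t in (0 : ℝ)..(2 * π), Real.cos (n * (t - θ)) * ((a t - d) * u t) = 0 := by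
    have e : ∀ t, Real.cos (n * (t - θ)) * ((a t - d) * u t) =
        Real.cos (n * θ) * (Real.cos (n * t) * ((a t - d) * u t)) +
        Real.sin (n * θ) * (Real.sin (n * t) * ((a t - d) * u t)) := fun t => by
      rw [mul_sub, Real.cos_sub]; ring
    simp only [e]
    rw [intervalIntegral.integral_add (Continuous.intervalIntegrable (by fun_prop) _ _)
      (Continuous.intervalIntegrable (by fun_prop) _ _), intervalIntegral.integral_const_mul,
      intervalIntegral.integral_const_mul, hcos, hsin]
    ring
  have hs : 0 < √π := Real.sqrt_pos.2 Real.pi_pos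
  have hs3 : √π ≤ 2 := by
    rw [Real.sqrt_le_left (by norm_num)]; linarith [Real.pi_le_four]
  have hmain : ∫ t in (0 : ℝ)..(2 * π), Real.cos (n * (t - θ)) ^ 2 * (a t - d) =
      π * (mean a - d) + (∫ t in (0 : ℝ)..(2 * π), a t * Real.cos ((2 * n : ℕ) * (t - θ))) / 2 := by
    have e : ∀ t, Real.cos (n * (t - θ)) ^ 2 * (a t - d) = a t / 2 +
        (a t * Real.cos ((2 * n : ℕ) * (t - θ)) / 2 - d * Real.cos (n * (t - θ)) ^ 2) := fun t => by
      rw [show ((2 * n : ℕ) : ℝ) * (t - θ) = 2 * (n * (t - θ)) by push_cast; ring, Real.cos_two_mul]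
      ring
    have c1 : Continuous fun t => a t / 2 := by fun_prop
    have c2 : Continuous fun t => a t * Real.cos ((2 * n : ℕ) * (t - θ)) / 2 := by fun_prop
    have c3 : Continuous fun t => d * Real.cos (n * (t - θ)) ^ 2 := by fun_prop
    have c4 : Continuous fun t => a t * Real.cos ((2 * n : ℕ) * (t - θ)) / 2 -
        d * Real.cos (n * (t - θ)) ^ 2 := by fun_prop
    simp only [e]
    rw [intervalIntegral.integral_add (c1.intervalIntegrable _ _)
      (c4.intervalIntegrable _ _), intervalIntegral.integral_sub
      (c2.intervalIntegrable _ _) (c3.intervalIntegrable _ _), intervalIntegral.integral_const_mul,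
      integral_cos_sq_shift hn.ne', intervalIntegral.integral_div, intervalIntegral.integral_div,
      mean]
    field_simp
    ring
  -- By `hphase`, replacing `u` with its leading term `π^{-1/2} cos` costs only the remainder, of
  -- size at most `δ`; the factor `2` bounds `√π`.
  have herr : |∫ t in (0 : ℝ)..(2 * π), Real.cos (n * (t - θ)) ^ 2 * (a t - d)| ≤
      2 * (2 * π * (M * δ)) := by
    have e : ∫ t in (0 : ℝ)..(2 * π), Real.cos (n * (t - θ)) ^ 2 * (a t - d) =
        -√π * ∫ t in (0 : ℝ)..(2 * π), Real.cos (n * (t - θ)) * ((a t - d) *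
          (u t - 1 / √π * Real.cos (n * (t - θ)))) := by
      have e1 : ∀ t, Real.cos (n * (t - θ)) * ((a t - d) * (u t - 1 / √π * Real.cos (n * (t - θ)))) =
          Real.cos (n * (t - θ)) * ((a t - d) * u t) -
            1 / √π * (Real.cos (n * (t - θ)) ^ 2 * (a t - d)) := fun t => by ring
      simp only [e1]
      rw [intervalIntegral.integral_sub (Continuous.intervalIntegrable (by fun_prop) _ _)
        (Continuous.intervalIntegrable (by fun_prop) _ _), hphase,
        intervalIntegral.integral_const_mul]
      field_simp
      ring
    rw [e, abs_mul, abs_neg, abs_of_pos hs]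
    have h := abs_integral_le_of_abs_le (x := 2 * π) (g := fun _ => M * δ)
      (f := fun t => Real.cos (n * (t - θ)) * ((a t - d) *
          (u t - 1 / √π * Real.cos (n * (t - θ))))) (by fun_prop) (by fun_prop)
      ⟨Real.two_pi_pos.le, le_rfl⟩ fun t => by
        rw [abs_mul, abs_mul]
        have h1 := mul_le_mul (hM t) (hclose t) (abs_nonneg _) hM0
        have h2 : 0 ≤ |a t - d| * |u t - 1 / √π * Real.cos (n * (t - θ))| := by positivity
        nlinarith [Real.abs_cos_le_one (n * (t - θ))]
    simp only [intervalIntegral.integral_const, sub_zero, smul_eq_mul] at h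
    exact mul_le_mul hs3 h (abs_nonneg _) (by norm_num)
  have hosc := abs_integral_mul_cos_le hap hac (m := 2 * n) (by omega) θ
  rw [hmain] at herr
  set J := ∫ t in (0 : ℝ)..(2 * π), a t * Real.cos ((2 * n : ℕ) * (t - θ))
  have hI : 0 ≤ ∫ t in (0 : ℝ)..(2 * π), |deriv a t| :=
    intervalIntegral.integral_nonneg Real.two_pi_pos.le fun _ _ => abs_nonneg _
  set I := ∫ t in (0 : ℝ)..(2 * π), |deriv a t|
  have hI2 : I / ((2 * n : ℕ) : ℝ) ≤ I / n := by
    gcongr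
    omega
  have h1 : π * |d - mean a| ≤ π * (I / n + 4 * M * δ) := by
    rw [← abs_of_pos Real.pi_pos, ← abs_mul, abs_of_pos Real.pi_pos]
    have e : π * (d - mean a) = -(π * (mean a - d) + J / 2) + J / 2 := by ring
    have h2 : |J / 2| ≤ I / n := by
      rw [abs_div, abs_two]
      have := abs_nonneg J
      linarith [hosc.trans hI2]
    have h3 : 0 ≤ I / n := by positivity
    rw [e]
    refine (abs_add_le _ _).trans ?_
    rw [abs_neg]
    nlinarith
  exact le_of_mul_le_mul_left h1 Real.pi_pos

/-! ### Enumeration, counting and labelling of the eigenvalues -/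

/-- A locally finite multiplicity function on the line that is bounded below and unbounded above
has an enumeration in increasing order. -/
theorem exists_enumeration {m : ℝ → ℕ} (hfin : ∀ R, {p : ℝ × ℕ | p.1 ≤ R ∧ p.2 < m p.1}.Finite)
    (hinf : ∀ R, ∃ l, R < l ∧ m l ≠ 0) :
    ∃ μ : ℕ → ℝ, Monotone μ ∧ Tendsto μ atTop atTop ∧ ∀ l, {k | μ k = l}.encard = m l := by
  classical
  -- Each `l` is replaced by `m l` copies, ordered lexicographically. Initial segments are finite
  -- and there is no largest element, so the order type is that of `ℕ`.
  let T := {p : ℝ ×ₗ ℕ // (ofLex p).2 < m (ofLex p).1}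
  have hIic : ∀ t : T, (Iic t).Finite := fun t => by
    refine Finite.of_finite_image (f := fun s : T => ofLex s.1) ?_ fun s _ s' _ h =>
      Subtype.ext (ofLex.injective h)
    refine (hfin (ofLex t.1).1).subset ?_
    rintro _ ⟨s, hs, rfl⟩
    exact ⟨Prod.Lex.monotone_fst _ _ hs, s.2⟩
  have hmem : ∀ R, ∃ t : T, R < (ofLex t.1).1 := fun R => by
    obtain ⟨l, hl, hm⟩ := hinf R
    exact ⟨⟨toLex (l, 0), Nat.pos_of_ne_zero hm⟩, hl⟩
  let : LocallyFiniteOrder T := LocallyFiniteOrder.ofFiniteIcc fun s t =>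
    (hIic t).subset fun _ hx => hx.2
  have hne : Nonempty T := ⟨(hmem 0).choose⟩
  have hbot : ∃ b : T, ∀ t, b ≤ t := by
    obtain ⟨t₀⟩ := hne
    obtain ⟨b, hb, hmin⟩ := exists_min_image (Iic t₀) id (hIic t₀) ⟨t₀, mem_Iic.2 le_rfl⟩
    refine ⟨b, fun t => ?_⟩
    rcases le_total t t₀ with h | h
    · exact hmin t h
    · exact le_trans hb h
  let : OrderBot T := { bot := hbot.choose, bot_le := hbot.choose_spec }
  have : NoMaxOrder T := ⟨fun t => by
    obtain ⟨s, hs⟩ := hmem (ofLex t.1).1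
    refine ⟨s, lt_of_not_ge fun h => ?_⟩
    exact absurd (Prod.Lex.monotone_fst _ _ h) (not_le.2 hs)⟩
  let := LinearLocallyFiniteOrder.succOrder T
  let := LinearLocallyFiniteOrder.predOrder T
  let e : T ≃o ℕ := orderIsoNatOfLinearSuccPredArch
  have hmono : Monotone fun k => (ofLex (e.symm k).1).1 := fun i j hij =>
    Prod.Lex.monotone_fst _ _ (e.symm.monotone hij)
  refine ⟨fun k => (ofLex (e.symm k).1).1, hmono, ?_, fun l => ?_⟩
  · refine tendsto_atTop_atTop_of_monotone hmono fun R => ?_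
    obtain ⟨t, ht⟩ := hmem R
    exact ⟨e t, by simpa using ht.le⟩
  · have hr : {k | (ofLex (e.symm k).1).1 = l} =
        range fun i : Fin (m l) => e ⟨toLex (l, i.1), i.2⟩ := by
      ext k
      constructor
      · rintro rfl
        exact ⟨⟨(ofLex (e.symm k).1).2, (e.symm k).2⟩, e.apply_symm_apply k⟩
      · rintro ⟨i, rfl⟩
        simp
    rw [hr, ← image_univ, InjOn.encard_image, encard_univ]
    · simp
    · intro i _ j _ h
      have := congrArg (fun t : T => (ofLex t.1).2) (e.injective h)
      exact Fin.ext this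

/-- The window is the single point `l`; all frequencies with `k² < l + 2α + 1` are put into `S`. -/
theorem finiteDimensional_hillSpace {a : ℝ → ℝ} (ha : Continuous a) {α : ℝ} (hα : ∀ x, |a x| ≤ α)
    (l : ℝ) : FiniteDimensional ℂ (hillSpace a l) := by
  have hα0 : 0 ≤ α := (abs_nonneg _).trans (hα 0)
  obtain ⟨N, hN⟩ := exists_nat_ge (|l| + 2 * α + 1)
  refine (sum_finrank_hillSpace_le ha hα (s := {l}) (S := Finset.Icc (-N : ℤ) N) (c := l) (C := 0)
    (d := 2 * α + 1) (by positivity) (by simp) (fun k hk => ?_) (by nlinarith)).1 l (by simp)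
  have h1 : (N : ℤ) < |k| := by
    by_contra h
    exact hk (Finset.mem_Icc.2 (abs_le.1 (not_lt.1 h)))
  have h2 : (N : ℝ) + 1 ≤ |(k : ℝ)| := by exact_mod_cast h1
  have h3 : (N : ℝ) ≤ (k : ℝ) ^ 2 := by
    rw [← sq_abs]
    nlinarith [abs_nonneg l]
  refine le_trans ?_ (le_abs_self _)
  linarith [le_abs_self l]

/-- If `l` is far from all squares, the counting bound applies with `S = ∅` and gives dimension
zero. -/
theorem exists_nat_sq_near {a : ℝ → ℝ} (ha : Continuous a) {α : ℝ} (hα : ∀ x, |a x| ≤ α)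
    {l : ℝ} (hl : Module.finrank ℂ (hillSpace a l) ≠ 0) :
    ∃ n : ℕ, |l - (n : ℝ) ^ 2| ≤ 2 * α + 1 := by
  have hα0 : 0 ≤ α := (abs_nonneg _).trans (hα 0)
  by_contra! hcon
  have h := (sum_finrank_hillSpace_le ha hα (s := {l}) (S := ∅) (c := l) (C := 0)
    (d := 2 * α + 1) (by positivity) (by simp) (fun k _ => ?_) (by nlinarith)).2
  · simp only [Finset.sum_singleton, Finset.card_empty] at h
    omega
  · have := hcon k.natAbs
    rw [abs_sub_comm, Nat.cast_natAbs, Int.cast_abs, sq_abs] at this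
    exact this.le

/-- Points of zero multiplicity are discarded first. The others are near squares, hence at least
`-(2α + 1)`, so they lie in the window `[-C, C]` around `c = 0`. -/
theorem exists_sum_finrank_le {a : ℝ → ℝ} (ha : Continuous a) {α : ℝ} (hα : ∀ x, |a x| ≤ α)
    (R : ℝ) : ∃ N : ℕ, ∀ s : Finset ℝ, (∀ l ∈ s, l ≤ R) →
      ∑ l ∈ s, Module.finrank ℂ (hillSpace a l) ≤ N := by
  have hα0 : 0 ≤ α := (abs_nonneg _).trans (hα 0)
  set C := max R (2 * α + 1) with hC
  have hC0 : 0 ≤ C := le_trans (by positivity) (le_max_right _ _)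
  obtain ⟨N, hN⟩ := exists_nat_ge (2 * (C + α))
  refine ⟨(Finset.Icc (-N : ℤ) N).card, fun s hs => ?_⟩
  rw [← Finset.sum_filter_ne_zero]
  refine (sum_finrank_hillSpace_le ha hα (c := 0) (C := C) (d := ((N : ℝ) + 1) ^ 2) (by positivity)
    (fun l hl => ?_) (fun k hk => ?_) ?_).2
  · rw [Finset.mem_filter] at hl
    obtain ⟨n, hn⟩ := exists_nat_sq_near ha hα hl.2
    rw [sub_zero, abs_le]
    refine ⟨?_, (hs l hl.1).trans (le_max_left _ _)⟩
    have := (abs_le.1 hn).1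
    have h2 : 2 * α + 1 ≤ C := le_max_right _ _
    nlinarith [sq_nonneg (n : ℝ)]
  · have h1 : (N : ℤ) < |k| := by
      by_contra h
      exact hk (Finset.mem_Icc.2 (abs_le.1 (not_lt.1 h)))
    have h2 : (N : ℝ) + 1 ≤ |(k : ℝ)| := by exact_mod_cast h1
    rw [sub_zero, abs_of_nonneg (sq_nonneg _), ← sq_abs (k : ℝ)]
    gcongr
  · have h1 : (2 * (C + α) + 1) ^ 2 ≤ ((N : ℝ) + 1) ^ 2 := by gcongr
    have h2 : 1 ≤ ((N : ℝ) + 1) ^ 2 := by nlinarith [Nat.cast_nonneg (α := ℝ) N]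
    nlinarith [mul_nonneg hC0 hα0]

theorem finite_setOf_lt_finrank {a : ℝ → ℝ} (ha : Continuous a) {α : ℝ} (hα : ∀ x, |a x| ≤ α)
    (R : ℝ) : {p : ℝ × ℕ | p.1 ≤ R ∧ p.2 < Module.finrank ℂ (hillSpace a p.1)}.Finite := by
  obtain ⟨N, hN⟩ := exists_sum_finrank_le ha hα R
  have hsupp : {l : ℝ | l ≤ R ∧ Module.finrank ℂ (hillSpace a l) ≠ 0}.Finite := by
    by_contra hinf
    obtain ⟨t, ht, hcard⟩ := Set.Infinite.exists_subset_card_eq hinf (N + 1)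
    have h1 := hN t fun l hl => (ht hl).1
    have h2 : ∑ l ∈ t, 1 ≤ ∑ l ∈ t, Module.finrank ℂ (hillSpace a l) :=
      Finset.sum_le_sum fun l hl => Nat.one_le_iff_ne_zero.2 (ht hl).2
    simp only [Finset.sum_const, smul_eq_mul, mul_one] at h2
    omega
  refine (hsupp.prod (finite_Iio N)).subset fun p hp => ⟨⟨hp.1, by have := hp.2; omega⟩, ?_⟩
  have := hN {p.1} fun l hl => by rw [Finset.mem_singleton.1 hl]; exact hp.1
  rw [Finset.sum_singleton] at this
  exact lt_of_lt_of_le hp.2 this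

/-- The multiplicities near a large square. -/
theorem exists_multiplicity_near_sq {a : ℝ → ℝ} (ha : Continuous a)
    (hap : Function.Periodic a (2 * π)) {α : ℝ} (hα : ∀ x, |a x| ≤ α) :
    ∃ n₀ : ℕ, ∀ n : ℕ, n₀ ≤ n → ∃ l₁ l₂ : ℝ,
      |l₁ - (n : ℝ) ^ 2| ≤ 2 * α + 1 ∧ |l₂ - (n : ℝ) ^ 2| ≤ 2 * α + 1 ∧
      ∀ l, |l - (n : ℝ) ^ 2| ≤ 2 * α + 1 → Module.finrank ℂ (hillSpace a l) =
        (if l = l₁ then 1 else 0) + if l = l₂ then 1 else 0 := by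
  have hα0 : 0 ≤ α := (abs_nonneg _).trans (hα 0)
  obtain ⟨n₁, hn₁⟩ := exists_eigenvalue_pair ha hap hα
  obtain ⟨n₂, hn₂⟩ := exists_nat_ge (4 * α + 4)
  refine ⟨max n₁ n₂, fun n hn => ?_⟩
  obtain ⟨l₁, l₂, h1, h2, hne1, hne2, heq⟩ := hn₁ n (le_of_max_le_left hn)
  have hnR : 4 * α + 4 ≤ n := hn₂.trans (by exact_mod_cast le_of_max_le_right hn)
  -- Only the frequencies `±n` are removed; the next square `(n - 1)²` is at distance `2n - 1`,
  -- which is the gap `d`.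
  have hle : ∀ s : Finset ℝ, (∀ l ∈ s, |l - (n : ℝ) ^ 2| ≤ 2 * α + 1) →
      ∑ l ∈ s, Module.finrank ℂ (hillSpace a l) ≤ 2 := fun s hs => by
    refine (sum_finrank_hillSpace_le ha hα (S := ({(n : ℤ), -(n : ℤ)} : Finset ℤ)) (d := 2 * n - 1) (by linarith) hs
      (fun k hk => ?_) (by nlinarith)).2.trans Finset.card_le_two
    have hkn : k.natAbs ≠ n := by
      simp only [Finset.mem_insert, Finset.mem_singleton, not_or] at hk
      omega
    have hk2 : (k : ℝ) ^ 2 = (k.natAbs : ℝ) ^ 2 := by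
      rw [Nat.cast_natAbs, Int.cast_abs, sq_abs]
    rw [hk2]
    rcases lt_or_gt_of_ne hkn with h | h
    · have h' : (k.natAbs : ℝ) + 1 ≤ n := by exact_mod_cast h
      rw [abs_sub_comm]
      refine le_trans ?_ (le_abs_self _)
      nlinarith [Nat.cast_nonneg (α := ℝ) k.natAbs]
    · have h' : (n : ℝ) + 1 ≤ k.natAbs := by exact_mod_cast h
      refine le_trans ?_ (le_abs_self _)
      nlinarith
  have hpos : ∀ l : ℝ, hillSpace a l ≠ ⊥ → 1 ≤ Module.finrank ℂ (hillSpace a l) := fun l hl => by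
    have := finiteDimensional_hillSpace ha hα l
    exact Submodule.one_le_finrank_iff.2 hl
  have p1 := hpos l₁ hne1
  have p2 := hpos l₂ hne2
  refine ⟨l₁, l₂, h1, h2, fun l hl => ?_⟩
  by_cases h12 : l₁ = l₂
  · have p3 := heq h12 (finiteDimensional_hillSpace ha hα l₁)
    subst h12
    by_cases hl1 : l = l₁
    · subst hl1
      have := hle {l} (by simpa using hl)
      rw [Finset.sum_singleton] at this
      simp only [if_true]
      omega
    · have := hle {l, l₁} (by simpa using And.intro hl h1)
      rw [Finset.sum_pair hl1] at this
      simp only [hl1, if_false]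
      omega
  · have q := hle {l₁, l₂} (by simpa using And.intro h1 h2)
    rw [Finset.sum_pair h12] at q
    by_cases hl1 : l = l₁
    · subst hl1
      simp only [h12, if_true, if_false]
      omega
    · by_cases hl2 : l = l₂
      · subst hl2
        simp only [hl1, if_true, if_false]
        omega
      · have q2 := hle {l, l₁, l₂} (by simpa using ⟨hl, h1, h2⟩)
        rw [Finset.sum_insert (by simp [hl1, hl2]), Finset.sum_pair h12] at q2
        simp only [hl1, hl2, if_false]
        omega

/-- If each large square has exactly two terms of a sequence nearby, then these terms can be
labelled by the integers of large modulus. -/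
theorem exists_labelling {μ : ℕ → ℝ} (hμ : Monotone μ) {C : ℝ} {N : ℕ} (hCN : 2 * C < 2 * N - 1)
    (hpair : ∀ n : ℕ, N ≤ n → {k | |μ k - (n : ℝ) ^ 2| ≤ C}.encard = 2)
    (hcov : ∀ k, ∃ n : ℕ, |μ k - (n : ℝ) ^ 2| ≤ C) :
    ∃ (kstar : ℕ) (σ : ℤ → ℕ), BijOn σ {j : ℤ | (N : ℤ) ≤ |j|} {k : ℕ | kstar ≤ k} ∧
      ∀ j : ℤ, (N : ℤ) ≤ |j| → |μ (σ j) - (j.natAbs : ℝ) ^ 2| ≤ C := by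
  classical
  have hex : ∀ n : ℕ, ∃ p : ℕ × ℕ, N ≤ n → p.1 ≠ p.2 ∧ {k | |μ k - (n : ℝ) ^ 2| ≤ C} = {p.1, p.2} :=
    fun n => by
      by_cases hn : N ≤ n
      · obtain ⟨x, y, hxy, h⟩ := encard_eq_two.1 (hpair n hn)
        exact ⟨(x, y), fun _ => ⟨hxy, h⟩⟩
      · exact ⟨(0, 0), fun h => absurd h hn⟩
  choose p hp using hex
  have hmem1 : ∀ n, N ≤ n → |μ (p n).1 - (n : ℝ) ^ 2| ≤ C := fun n hn => by
    have : (p n).1 ∈ {k | |μ k - (n : ℝ) ^ 2| ≤ C} := by rw [(hp n hn).2]; simp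
    exact this
  have hmem2 : ∀ n, N ≤ n → |μ (p n).2 - (n : ℝ) ^ 2| ≤ C := fun n hn => by
    have : (p n).2 ∈ {k | |μ k - (n : ℝ) ^ 2| ≤ C} := by rw [(hp n hn).2]; simp
    exact this
  -- Distinct squares differ by at least `2n' - 1 ≥ 2N - 1 > 2C`, so the windows are disjoint.
  have hsep : ∀ n n' : ℕ, N ≤ n' → n < n' → (n : ℝ) ^ 2 + C < (n' : ℝ) ^ 2 - C := by
    intro n n' hn' hlt
    have h1 : (n : ℝ) + 1 ≤ n' := by exact_mod_cast hlt
    have h2 : (N : ℝ) ≤ n' := by exact_mod_cast hn'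
    nlinarith [Nat.cast_nonneg (α := ℝ) n]
  have hdisj : ∀ n n' : ℕ, N ≤ n → N ≤ n' → ∀ k, |μ k - (n : ℝ) ^ 2| ≤ C →
      |μ k - (n' : ℝ) ^ 2| ≤ C → n = n' := by
    intro n n' hn hn' k h h'
    rw [abs_le] at h h'
    rcases lt_trichotomy n n' with hlt | rfl | hlt
    · have := hsep n n' hn' hlt
      linarith
    · rfl
    · have := hsep n' n hn hlt
      linarith
  have hexk : ∃ k, (N : ℝ) ^ 2 - C ≤ μ k := ⟨(p N).1, by
    have := (abs_le.1 (hmem1 N le_rfl)).1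
    linarith⟩
  -- Of the two indices in the window of `n²`, one is given to `n` and the other to `-n`.
  set σ : ℤ → ℕ := fun j => if 0 ≤ j then (p j.natAbs).1 else (p j.natAbs).2 with hσ
  have hnat : ∀ j : ℤ, (N : ℤ) ≤ |j| → N ≤ j.natAbs := fun j hj => by
    have := Int.natCast_natAbs j
    omega
  have hclose : ∀ j : ℤ, (N : ℤ) ≤ |j| → |μ (σ j) - (j.natAbs : ℝ) ^ 2| ≤ C := fun j hj => by
    simp only [hσ]
    split_ifs
    · exact hmem1 _ (hnat j hj)
    · exact hmem2 _ (hnat j hj)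
  -- The tail starts at the first term that reaches the lower end of the window of `N²`; by
  -- monotonicity and separation it consists exactly of the terms in the windows with `n ≥ N`.
  refine ⟨Nat.find hexk, σ, ⟨fun j hj => ?_, fun j hj j' hj' h => ?_, fun k hk => ?_⟩, hclose⟩
  · have h1 := (abs_le.1 (hclose j hj)).1
    have h2 : (N : ℝ) ≤ j.natAbs := by exact_mod_cast hnat j hj
    exact Nat.find_min' hexk (by nlinarith [Nat.cast_nonneg (α := ℝ) N])
  · have h1 := hclose j hj
    have h2 := hclose j' hj'
    rw [← h] at h2
    have habs := hdisj _ _ (hnat j hj) (hnat j' hj') _ h1 h2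
    have hne := (hp _ (hnat j hj)).1
    simp only [hσ, ← habs] at h
    split_ifs at h with ha hb hb
    · omega
    · exact absurd h hne
    · exact absurd h.symm hne
    · omega
  · have hk' : (N : ℝ) ^ 2 - C ≤ μ k := (Nat.find_spec hexk).trans (hμ hk)
    obtain ⟨n, hn⟩ := hcov k
    have hNn : N ≤ n := by
      by_contra hlt
      have := hsep n N le_rfl (not_le.1 hlt)
      linarith [(abs_le.1 hn).2]
    have hkm : k ∈ ({(p n).1, (p n).2} : Set ℕ) := by rw [← (hp n hNn).2]; exact hn
    -- The labels `n` and `-n` must differ. The value `n = 0` would force `N = 0` and then `2C <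
    -- -1`, while `C ≥ 0`.
    by_cases hn0 : n = 0
    · exfalso
      subst hn0
      have hN0 : N = 0 := by omega
      subst hN0
      have := (abs_nonneg _).trans hn
      norm_num at hCN
      linarith
    rcases hkm with rfl | hkm
    · refine ⟨n, ?_, ?_⟩
      · simpa using hNn
      · simp [hσ]
    · rw [mem_singleton_iff] at hkm
      refine ⟨-n, ?_, ?_⟩
      · simpa using hNn
      · have : ¬ (0 : ℤ) ≤ -n := by omega
        simp only [hσ, this, if_false, Int.natAbs_neg, Int.natAbs_natCast, hkm]

/-- As `a` and `l` are real, the real and imaginary parts of a solution are solutions, and one of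
them is nonzero. The functional `L` in `key` stands for either part. -/
theorem exists_normalized_real_solution {a : ℝ → ℝ} {l : ℝ} (h : hillSpace a l ≠ ⊥) :
    ∃ u v : ℝ → ℝ, Function.Periodic u (2 * π) ∧ (∀ x, HasDerivAt u (v x) x) ∧
      (∀ x, HasDerivAt v ((a x - l) * u x) x) ∧ ∫ t in (0 : ℝ)..(2 * π), u t ^ 2 = 1 := by
  obtain ⟨f, ⟨hfp, g, hfg, hgf⟩, hf0⟩ := Submodule.exists_mem_ne_zero_of_ne_bot h
  have key : ∀ L : ℂ →L[ℝ] ℝ, (∀ (r : ℝ) (z : ℂ), L (r * z) = r * L z) → (∃ x, L (f x) ≠ 0) →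
      ∃ u v : ℝ → ℝ, Function.Periodic u (2 * π) ∧ (∀ x, HasDerivAt u (v x) x) ∧
      (∀ x, HasDerivAt v ((a x - l) * u x) x) ∧ ∫ t in (0 : ℝ)..(2 * π), u t ^ 2 = 1 := by
    rintro L hL ⟨x, hx⟩
    set u : ℝ → ℝ := fun t => L (f t) with hu
    have hup : Function.Periodic u (2 * π) := fun t => by simp only [hu, hfp t]
    have huv : ∀ t, HasDerivAt u (L (g t)) t := fun t => L.hasFDerivAt.comp_hasDerivAt t (hfg t)
    have hvu : ∀ t, HasDerivAt (fun t => L (g t)) ((a t - l) * u t) t := fun t => by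
      refine (L.hasFDerivAt.comp_hasDerivAt t (hgf t)).congr_deriv ?_
      rw [← Complex.ofReal_sub, hL]
    have huc : Continuous u := continuous_iff_continuousAt.2 fun x => (huv x).continuousAt
    obtain ⟨y, hy, hxy⟩ := hup.exists_mem_Ico₀ Real.two_pi_pos x
    have hpos : 0 < ∫ t in (0 : ℝ)..(2 * π), u t ^ 2 :=
      intervalIntegral.integral_pos Real.two_pi_pos (by fun_prop) (fun _ _ => by positivity)
        ⟨y, Ico_subset_Icc_self hy, by
          have : u y ≠ 0 := by rw [← hxy]; exact hx
          positivity⟩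
    set I := ∫ t in (0 : ℝ)..(2 * π), u t ^ 2
    refine ⟨fun t => (√I)⁻¹ * u t, fun t => (√I)⁻¹ * L (g t), fun t => by simp only [hup t],
      fun t => (huv t).const_mul _, fun t => ((hvu t).const_mul _).congr_deriv (by ring), ?_⟩
    simp only [mul_pow]
    rw [intervalIntegral.integral_const_mul, inv_pow, Real.sq_sqrt hpos.le, inv_mul_cancel₀ hpos.ne']
  by_cases hre : ∃ x, (f x).re ≠ 0
  · exact key Complex.reCLM (fun r z => by simp) hre
  · refine key Complex.imCLM (fun r z => by simp) ?_
    by_contra him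
    push Not at hre him
    exact hf0 (funext fun x => Complex.ext (hre x) (him x))

/-! ### Return to the magnetic operator -/

theorem MemW1.exists_bound {a : ℝ → ℝ} {p : ℝ≥0∞} (ha : MemW1 p a) : ∃ α, ∀ x, |a x| ≤ α := by
  obtain ⟨α, hα⟩ := ha.absCont.exists_bound
  refine ⟨α, fun x => ?_⟩
  obtain ⟨y, hy, hxy⟩ := ha.periodic.exists_mem_Ico₀ Real.two_pi_pos x
  rw [hxy]
  exact hα y (by rw [uIcc_of_le Real.two_pi_pos.le]; exact Ico_subset_Icc_self hy)

theorem toENat_rank_eigenspace {A a : ℝ → ℝ} {p : ℝ≥0∞} (ha : MemW1 p a) (hA : MemW1 ⊤ A)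
    {n : ℤ} (hn : mean A = n) (l : ℝ) :
    Cardinal.toENat (Module.rank ℂ (eigenspace A a l)) = Module.finrank ℂ (hillSpace a l) := by
  obtain ⟨α, hα⟩ := ha.exists_bound
  have := finiteDimensional_hillSpace ha.continuous hα l
  rw [rank_eigenspace ha hA hn, ← Module.finrank_eq_rank]
  simp

theorem exists_isEigenvalueSeq {A a : ℝ → ℝ} {p : ℝ≥0∞} (ha : MemW1 p a) (hA : MemW1 ⊤ A)
    {n : ℤ} (hn : mean A = n) : ∃ μ : ℕ → ℝ, IsEigenvalueSeq A a μ ∧ Tendsto μ atTop atTop := by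
  obtain ⟨α, hα⟩ := ha.exists_bound
  obtain ⟨n₀, hn₀⟩ := exists_multiplicity_near_sq ha.continuous ha.periodic hα
  have hα0 : 0 ≤ α := (abs_nonneg _).trans (hα 0)
  obtain ⟨μ, hmono, htend, hμ⟩ := exists_enumeration
    (m := fun l : ℝ => Module.finrank ℂ (hillSpace a l)) (finite_setOf_lt_finrank ha.continuous hα) fun R => by
      obtain ⟨k, hk⟩ := exists_nat_ge (R + 2 * α + 2)
      obtain ⟨l₁, l₂, h1, -, h⟩ := hn₀ (max n₀ (k + 1)) (le_max_left _ _)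
      refine ⟨l₁, ?_, by simp only [h l₁ h1, if_pos]; omega⟩
      have h2 : (k : ℝ) + 1 ≤ (max n₀ (k + 1) : ℕ) := by exact_mod_cast le_max_right _ _
      have h3 := (abs_le.1 h1).1
      nlinarith [Nat.cast_nonneg (α := ℝ) k]
  refine ⟨μ, ⟨hmono, fun z => ?_⟩, htend⟩
  by_cases hz : z.im = 0
  · obtain ⟨l, rfl⟩ : ∃ l : ℝ, z = l := ⟨z.re, Complex.ext rfl (by simpa using hz)⟩
    rw [toENat_rank_eigenspace ha hA hn, ← hμ l]
    simp only [Complex.ofReal_inj]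
  · have hempty : {k : ℕ | (μ k : ℂ) = z} = ∅ := by
      refine eq_empty_of_forall_notMem fun k hk => hz ?_
      rw [← show (μ k : ℂ) = z from hk, Complex.ofReal_im]
    rw [hempty, encard_empty, rank_eigenspace ha hA hn, hillSpace_eq_bot_of_im_ne_zero hz, rank_bot,
      map_zero]

/-- The terms of an eigenvalue sequence come in pairs near the large squares. -/
theorem IsEigenvalueSeq.encard_near_sq {A a : ℝ → ℝ} {μ : ℕ → ℝ} (hμ : IsEigenvalueSeq A a μ)
    {p : ℝ≥0∞} (ha : MemW1 p a) (hA : MemW1 ⊤ A) {N : ℤ} (hN : mean A = N) {C : ℝ} {n : ℕ}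
    (h : ∃ l₁ l₂ : ℝ, |l₁ - (n : ℝ) ^ 2| ≤ C ∧ |l₂ - (n : ℝ) ^ 2| ≤ C ∧
      ∀ l, |l - (n : ℝ) ^ 2| ≤ C → Module.finrank ℂ (hillSpace a l) =
        (if l = l₁ then 1 else 0) + if l = l₂ then 1 else 0) :
    {k | |μ k - (n : ℝ) ^ 2| ≤ C}.encard = 2 := by
  obtain ⟨l₁, l₂, h1, h2, h⟩ := h
  have hm : ∀ l : ℝ, {k | μ k = l}.encard = Module.finrank ℂ (hillSpace a l) := fun l => by
    rw [← toENat_rank_eigenspace ha hA hN, ← hμ.mult]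
    simp only [Complex.ofReal_inj]
  have hset : {k | |μ k - (n : ℝ) ^ 2| ≤ C} = {k | μ k = l₁} ∪ {k | μ k = l₂} := by
    ext k
    constructor
    · intro hk
      by_contra hne
      simp only [mem_union, mem_ofPred_eq, not_or] at hne
      have h0 := hm (μ k)
      rw [h _ hk, if_neg hne.1, if_neg hne.2] at h0
      have h0' : {k' | μ k' = μ k}.encard = 0 := h0.trans (by simp)
      have : k ∈ {k' | μ k' = μ k} := rfl
      rw [encard_eq_zero.1 h0'] at this
      exact this
    · rintro (hk | hk)
      · rw [mem_ofPred_eq] at hk ⊢; rw [hk]; exact h1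
      · rw [mem_ofPred_eq] at hk ⊢; rw [hk]; exact h2
  rw [hset]
  by_cases h12 : l₁ = l₂
  · subst h12
    rw [union_self, hm, h _ h1]
    simp only [if_true]
    norm_num
  · rw [encard_union_eq, hm, hm, h _ h1, h _ h2]
    · simp only [if_true, h12, Ne.symm h12, if_false]
      norm_num
    · exact disjoint_left.2 fun k hk hk' => h12 (by
        rw [← show μ k = l₁ from hk, ← show μ k = l₂ from hk'])

theorem eigenvalue_seq_asymptotics {a A : ℝ → ℝ} (ha : MemW1 ⊤ a) (hA : MemW1 ⊤ A) {N : ℤ}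
    (hN : mean A = N) {μ : ℕ → ℝ} (hμ : IsEigenvalueSeq A a μ) :
    ∃ (kstar ℓ : ℕ) (σ : ℤ → ℕ) (K : ℝ), 0 < ℓ ∧
      BijOn σ {j : ℤ | (ℓ : ℤ) ≤ |j|} {k : ℕ | kstar ≤ k} ∧
      ∀ j : ℤ, (ℓ : ℤ) ≤ |j| → |μ (σ j) - (mean a + (j : ℝ) ^ 2)| ≤ K / |(j : ℝ)| ∧
        ∃ θ ∈ Icc 0 (2 * π), ∃ u : ℝ → ℝ, (fun t => (u t : ℂ)) ∈ hillSpace a (μ (σ j)) ∧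
          (∫ t in (0 : ℝ)..(2 * π), u t ^ 2) = 1 ∧
          ∀ t, |u t - 1 / √π * Real.cos (j * (t - θ))| ≤ K / |(j : ℝ)| := by
  obtain ⟨α, hα⟩ := ha.exists_bound
  have hα0 : 0 ≤ α := (abs_nonneg _).trans (hα 0)
  have hac := ha.continuous
  obtain ⟨n₀, hn₀⟩ := exists_multiplicity_near_sq hac ha.periodic hα
  set M := α + (2 * α + 1) with hM
  -- The first summand meets the smallness condition of `eigenfunction_asymptotics`; the summand `2α
  -- + 2` separates the windows, as `2(2α + 1) < 2ℓ - 1`.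
  obtain ⟨n₁, hn₁⟩ := exists_nat_ge (M * (2 * π + 1) + 2 * α + 2)
  set ℓ := max n₀ n₁ with hℓ
  have hMpos : 0 ≤ M * (2 * π + 1) := by positivity
  have hℓR : M * (2 * π + 1) + 2 * α + 2 ≤ ℓ := hn₁.trans (by exact_mod_cast le_max_right _ _)
  have hℓ0 : 0 < ℓ := by
    have : (0 : ℝ) < ℓ := by linarith
    exact_mod_cast this
  have hne : ∀ k, Module.finrank ℂ (hillSpace a (μ k)) ≠ 0 := fun k h0 => by
    have h1 := hμ.mult (μ k)
    rw [toENat_rank_eigenspace ha hA hN, h0, Nat.cast_zero, encard_eq_zero] at h1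
    have : k ∈ {k' | (μ k' : ℂ) = μ k} := rfl
    rw [h1] at this
    exact this
  obtain ⟨kstar, σ, hσ, hclose⟩ := exists_labelling hμ.mono (C := 2 * α + 1) (N := ℓ)
    (by linarith) (fun n hn => hμ.encard_near_sq ha hA hN (hn₀ n ((le_max_left _ _).trans hn)))
    fun k => exists_nat_sq_near hac hα (hne k)
  set I := ∫ t in (0 : ℝ)..(2 * π), |deriv a t|
  have hI : 0 ≤ I := intervalIntegral.integral_nonneg Real.two_pi_pos.le fun _ _ => abs_nonneg _
  set D := 29 * (M * (2 * π + 1)) with hD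
  refine ⟨kstar, ℓ, σ, I + 4 * M * D + D, hℓ0, hσ, fun j hj => ?_⟩
  have hn : ℓ ≤ j.natAbs := by
    have := Int.natCast_natAbs j
    omega
  have hjn : |(j : ℝ)| = j.natAbs := by rw [Nat.cast_natAbs, Int.cast_abs]
  have hj2 : (j : ℝ) ^ 2 = (j.natAbs : ℝ) ^ 2 := by rw [← hjn, sq_abs]
  have hnR : (ℓ : ℝ) ≤ j.natAbs := by exact_mod_cast hn
  have hn0 : 0 < j.natAbs := by omega
  have hnear := hclose j hj
  set n := j.natAbs
  set l := μ (σ j)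
  obtain ⟨u, v, hup, huv, hvu, hnorm⟩ := exists_normalized_real_solution (a := a) (l := l) fun h =>
    hne (σ j) (by
      change Module.finrank ℂ (hillSpace a (l : ℂ)) = 0
      rw [h]; exact finrank_bot ℂ _)
  have hb : ∀ x, |a x - (l - (n : ℝ) ^ 2)| ≤ M := fun x =>
    (abs_sub _ _).trans (add_le_add (hα x) hnear)
  have hvu' : ∀ x, HasDerivAt v ((a x - (l - (n : ℝ) ^ 2)) * u x - (n : ℝ) ^ 2 * u x) x :=
    fun x => (hvu x).congr_deriv (by ring)
  obtain ⟨θ, hθ, hu⟩ := eigenfunction_asymptotics (b := fun x => a x - (l - (n : ℝ) ^ 2))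
    (by fun_prop) hb hn0 (by linarith) hup huv hvu' hnorm
  have hl := eigenvalue_asymptotics hac ha.periodic ha.absCont hb hn0 hup huv hvu' hu
  rw [hjn, hj2]
  have hn' : (0 : ℝ) < n := by positivity
  have hD0 : 0 ≤ D := by positivity
  refine ⟨?_, θ, hθ, u, ofReal_mem_hillSpace hup huv hvu, hnorm, fun t => ?_⟩
  · rw [show l - (mean a + (n : ℝ) ^ 2) = l - (n : ℝ) ^ 2 - mean a by ring]
    refine (hl.trans_eq (b := I / n + 4 * M * (D / n)) rfl).trans ?_
    rw [← mul_div_assoc, ← add_div]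
    exact div_le_div_of_nonneg_right (by linarith) hn'.le
  -- The estimates are for `n = |j|`; since cosine is even, the sign of `j` does not matter.
  · have hcos : Real.cos (j * (t - θ)) = Real.cos (n * (t - θ)) := by
      rw [← hjn, ← Real.cos_abs (j * (t - θ)), ← Real.cos_abs (|(j : ℝ)| * (t - θ)), abs_mul,
        abs_mul, abs_abs]
    rw [hcos]
    refine (hu t).trans ?_
    gcongr
    have : 0 ≤ I + 4 * M * D := by positivity
    linarith

end MagneticCircle

/-- Sequences are indexed from `0`, so the tail `k > k*` of a list indexed from `1` becomes `kstar ≤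
k`, and `cofinite` on `ℤ` encodes `|j| → ∞`. The gauge factor has modulus one, so normalisation and
remainder bounds pass unchanged from Hill's equation. -/
theorem lemmaB4 (a A : ℝ → ℝ)
    (ha : MagneticCircle.MemW1 ⊤ a) (hA : MagneticCircle.MemW1 ⊤ A)
    (hAint : ∃ n : ℤ, MagneticCircle.mean A = (n : ℝ)) :
    (∃ μ : ℕ → ℝ, MagneticCircle.IsEigenvalueSeq A a μ ∧ Tendsto μ atTop atTop) ∧
    ∀ μ : ℕ → ℝ, MagneticCircle.IsEigenvalueSeq A a μ →
      ∃ (kstar ℓ : ℕ) (lam : ℤ → ℝ),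
        (∃ σ : ℤ → ℕ, BijOn σ {j : ℤ | (ℓ : ℤ) ≤ |j|} {k : ℕ | kstar ≤ k} ∧
          ∀ j : ℤ, (ℓ : ℤ) ≤ |j| → lam j = μ (σ j)) ∧
        ((fun j : ℤ => lam j - (MagneticCircle.mean a + (j : ℝ) ^ 2))
          =O[cofinite] fun j : ℤ => 1 / |(j : ℝ)|) ∧
        ∃ (θ : ℤ → ℝ) (φ R : ℤ → ℝ → ℂ),
          (∀ j : ℤ, (ℓ : ℤ) ≤ |j| →
            θ j ∈ Icc 0 (2 * π) ∧
            φ j ∈ MagneticCircle.eigenspace A a (lam j : ℂ) ∧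
            (∫ t in (0 : ℝ)..(2 * π), ‖φ j t‖ ^ 2) = 1 ∧
            ∀ t : ℝ, φ j t =
              ((1 / √π : ℝ) : ℂ) * Complex.exp (-Complex.I * ((∫ s in (0 : ℝ)..t, A s : ℝ) : ℂ)) *
                (Real.cos ((j : ℝ) * (t - θ j)) : ℂ) + R j t) ∧
          ∃ C : ℝ, ∀ᶠ j : ℤ in cofinite, ∀ t : ℝ, ‖R j t‖ ≤ C / |(j : ℝ)| := by
  obtain ⟨N, hN⟩ := hAint
  refine ⟨MagneticCircle.exists_isEigenvalueSeq ha hA hN, fun μ hμ => ?_⟩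
  obtain ⟨kstar, ℓ, σ, K, hℓ, hσ, h⟩ := MagneticCircle.eigenvalue_seq_asymptotics ha hA hN hμ
  have hlarge : ∀ᶠ j : ℤ in cofinite, (ℓ : ℤ) ≤ |j| := by
    refine (Set.finite_Ioo (-(ℓ : ℤ)) ℓ).subset fun j hj => ?_
    exact abs_lt.1 (not_le.1 hj)
  have hex : ∀ j : ℤ, ∃ (θ : ℝ) (u : ℝ → ℝ), (ℓ : ℤ) ≤ |j| → θ ∈ Icc 0 (2 * π) ∧
      (fun t => (u t : ℂ)) ∈ MagneticCircle.hillSpace a (μ (σ j)) ∧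
      (∫ t in (0 : ℝ)..(2 * π), u t ^ 2) = 1 ∧
      ∀ t, |u t - 1 / √π * Real.cos (j * (t - θ))| ≤ K / |(j : ℝ)| := fun j => by
    by_cases hj : (ℓ : ℤ) ≤ |j|
    · obtain ⟨-, θ, hθ, u, hu⟩ := h j hj
      exact ⟨θ, u, fun _ => ⟨hθ, hu⟩⟩
    · exact ⟨0, 0, fun hj' => absurd hj' hj⟩
  choose θ u hu using hex
  have hgauge : ∀ t, Complex.exp (-Complex.I * ((∫ s in (0 : ℝ)..t, A s : ℝ) : ℂ)) =
      MagneticCircle.gauge A (-1) t := fun t => by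
    rw [MagneticCircle.gauge, neg_one_mul]
  refine ⟨kstar, ℓ, fun j => μ (σ j), ⟨σ, hσ, fun _ _ => rfl⟩, ?_, θ,
    fun j => MagneticCircle.gauge A (-1) * fun t => (u j t : ℂ),
    fun j t => MagneticCircle.gauge A (-1) t * ((u j t - 1 / √π * Real.cos (j * (t - θ j)) : ℝ) : ℂ),
    fun j hj => ?_, K, ?_⟩
  · refine IsBigO.of_bound K ?_
    filter_upwards [hlarge] with j hj
    rw [Real.norm_eq_abs, Real.norm_eq_abs, abs_of_nonneg (by positivity : 0 ≤ 1 / |(j : ℝ)|),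
      mul_one_div]
    exact (h j hj).1
  · obtain ⟨h1, h2, h3, -⟩ := hu j hj
    refine ⟨h1, MagneticCircle.gauge_mul_mem_eigenspace ha hA hN h2, ?_, fun t => ?_⟩
    · rw [← h3]
      refine intervalIntegral.integral_congr fun t _ => ?_
      simp only [Pi.mul_apply, norm_mul, MagneticCircle.norm_gauge_neg_one, one_mul,
        Complex.norm_real, Real.norm_eq_abs, sq_abs]
    · simp only [hgauge, Pi.mul_apply]
      push_cast
      ring
  · filter_upwards [hlarge] with j hj t
    rw [norm_mul, MagneticCircle.norm_gauge_neg_one, one_mul, Complex.norm_real, Real.norm_eq_abs]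
    exact (hu j hj).2.2.2 t
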